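/- Fix $m\ge 1$. For each sample size $n$, let $X_1,\dots,X_n$ be random vectors in $\mathbb{R}^m$ defined on a probability space that may depend on $n$ (a triangular array: the joint law of $\mathbf{X}=(X_1,\dots,X_n)$ may depend on $n$ and the dependence among the $X_i$ is arbitrary), let $\mu_0=\mu_{0,n}\in\mathbb{R}^m$ be nonrandom, and let $R_n\ge 1$ be an integer. Let $\pi=(\pi_r)_{r=1}^{R_n}$ be i.i.d. uniform random permutations of $\{1,\dots,n\}$, independent of $\mathbf{X}$. Write $\bar X=n^{-1}\sum_{i=1}^n X_i$ and $\hat\Sigma=n^{-1}\sum_{i=1}^n(X_i-\bar X)(X_i-\bar X)'$, and for $\mu\in\mathbb{R}^m$ and $n\ge 2$ define $$\tilde T_M(\mu;\pi)=\frac1{\sqrt{R_n}}\sum_{r=1}^{R_n}\hat\Sigma^{-1/2}(X_{\pi_r(1)}-\mu),\qquad T_M(\mu;\pi)=\tilde T_M(\mu;\pi)'\,\tilde T_M(\mu;\pi),$$ $$T_U(\mu;\pi)=\frac1{\sqrt{mR_n}}\sum_{r=1}^{R_n}(X_{\pi_r(1)}-\mu)'\hat\Sigma^{-1}(X_{\pi_r(2)}-\mu),$$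 where $\hat\Sigma^{-1/2}$ is the inverse of the positive semidefinite square root of $\hat\Sigma$ (inverses of singular matrices are read as $0$). Suppose that, as $n\to\infty$, with $\|\cdot\|$ the sup norm, (a) $n^{-1/2}\sum_{i=1}^n(X_i-\mu_0)=O_p(1)$; (b) $\hat\Sigma\to\Sigma$ in probability for some (nonrandom, fixed) positive-definite matrix $\Sigma$; (c) $n^{-1}\sum_{i=1}^n\|X_i\|^{2+\delta}=O_p(1)$ for some $\delta>0$. Let $R_n\to\infty$. 1. If $R_n/n\to0$, then for $T_n=\tilde T_M(\mu_0;\pi)$ and for $T_n=\tilde T_M(\bar X;\pi)$ the conditional CDF $\mathbf P(T_n\le t\mid\mathbf{X})$ (componentwise order) converges in probability, for every $t\in\mathbb{R}^m$, to the CDF of $\mathcal N(0,I_m)$ at $t$. Moreover $T_M(\mu_0;\pi)$ and $T_M(\bar X;\pi)$ converge in distribution to $\chi^2_m$, the chi-square distribution with $m$ degrees of freedom, and for $T_n$ equal to either of them $$\sup_{t\in\mathbb{R}}\big|\mathbf P(T_n\le t\mid\mathbf{X})-\chi^2_m((-\infty,t])\big|\to0\quad\text{in probability}.$$ 2. If $\sqrt{R_n}/n\to0$,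 then $T_U(\mu_0;\pi)$ and $T_U(\bar X;\pi)$ converge in distribution to $\mathcal N(0,1)$, and for $T_n$ equal to either of them, with $\Phi$ the standard normal CDF, $$\sup_{t\in\mathbb{R}}\big|\mathbf P(T_n\le t\mid\mathbf{X})-\Phi(t)\big|\to0\quad\text{in probability}.$$ -/

import Mathlib

open MeasureTheory ProbabilityTheory Filter Topology

noncomputable section

namespace Resampling

section Statistics

/-- Permutations of a finite set carry the discrete σ-algebra. -/
instance permMeasurableSpace (n : ℕ) : MeasurableSpace (Equiv.Perm (Fin n)) := ⊤

instance permDiscreteMeasurableSpace (n : ℕ) :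
    DiscreteMeasurableSpace (Equiv.Perm (Fin n)) := ⟨fun _ => trivial⟩

/-- The sample mean of the data set `x 0, …, x (n - 1)` in `ℝ^m`. -/
def sampleMean {n m : ℕ} (x : Fin n → Fin m → ℝ) : Fin m → ℝ :=
  (n : ℝ)⁻¹ • ∑ i, x i

/-- The (naive) sample variance matrix `n⁻¹ ∑ᵢ (xᵢ - x̄) (xᵢ - x̄)'`. -/
def sampleVar {n m : ℕ} (x : Fin n → Fin m → ℝ) : Matrix (Fin m) (Fin m) ℝ :=
  (n : ℝ)⁻¹ • ∑ i, Matrix.vecMulVec (x i - sampleMean x) (x i - sampleMean x)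

/-- The observation `x_{σ(k+1)}` (positions are counted from `0` here). The value `0` is used for
`n ≤ k` only; as `k` is `0` or `1` below, this concerns only the sample sizes `n < 2`. -/
def drawn {n m : ℕ} (x : Fin n → Fin m → ℝ) (σ : Equiv.Perm (Fin n)) (k : ℕ) : Fin m → ℝ :=
  if h : k < n then x (σ ⟨k, h⟩) else 0

open scoped MatrixOrder in
/-- `S^{-1/2}`: the inverse of the positive semidefinite square root of `S`. -/
def invSqrt {m : ℕ} (S : Matrix (Fin m) (Fin m) ℝ) : Matrix (Fin m) (Fin m) ℝ :=
  (CFC.sqrt S)⁻¹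

/-- The vector `R^{-1/2} ∑ᵣ Σ̂^{-1/2} (x_{πᵣ(1)} - μ)`. -/
def meanVec {n m R : ℕ} (x : Fin n → Fin m → ℝ) (μ : Fin m → ℝ)
    (π : Fin R → Equiv.Perm (Fin n)) : Fin m → ℝ :=
  (√(R : ℝ))⁻¹ • ∑ r, Matrix.mulVec (invSqrt (sampleVar x)) (drawn x (π r) 0 - μ)

/-- The mean-type statistic `T_M(μ; π)`. -/
def meanStat {n m R : ℕ} (x : Fin n → Fin m → ℝ) (μ : Fin m → ℝ)
    (π : Fin R → Equiv.Perm (Fin n)) : ℝ :=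
  dotProduct (meanVec x μ π) (meanVec x μ π)

/-- The U-type statistic
`T_U(μ; π) = (m R)^{-1/2} ∑ᵣ (x_{πᵣ(1)} - μ)' Σ̂⁻¹ (x_{πᵣ(2)} - μ)`. -/
def uStat {n m R : ℕ} (x : Fin n → Fin m → ℝ) (μ : Fin m → ℝ)
    (π : Fin R → Equiv.Perm (Fin n)) : ℝ :=
  (√((m : ℝ) * (R : ℝ)))⁻¹ *
    ∑ r, dotProduct (drawn x (π r) 0 - μ)
      (Matrix.mulVec (sampleVar x)⁻¹ (drawn x (π r) 1 - μ))

end Statistics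

section Limits

/-- The standard normal distribution `N(0, I_m)` on `ℝ^m`. -/
def stdNormal (m : ℕ) : Measure (Fin m → ℝ) := Measure.pi fun _ => gaussianReal 0 1

instance isProbabilityMeasure_stdNormal (m : ℕ) : IsProbabilityMeasure (stdNormal m) := by
  unfold stdNormal; infer_instance

/-- The chi-square distribution with `m` degrees of freedom: the law of the sum of the squares of
`m` independent standard normal variables. -/
def chiSquare (m : ℕ) : Measure ℝ := (stdNormal m).map fun z => ∑ i, z i ^ 2

instance isProbabilityMeasure_chiSquare (m : ℕ) : IsProbabilityMeasure (chiSquare m) :=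
  Measure.isProbabilityMeasure_map
    (Finset.measurable_sum _ fun i _ => (measurable_pi_apply i).pow_const 2).aemeasurable

end Limits

section Convergence

/-- `Yₙ = O_p(1)`, where `Yₙ` lives on the `n`-th probability space. -/
def BoundedInProb {Ω : ℕ → Type*} [∀ n, MeasurableSpace (Ω n)] {E : Type*} [Norm E]
    (P : ∀ n, Measure (Ω n)) (Y : ∀ n, Ω n → E) : Prop :=
  ∀ ε : ℝ, 0 < ε → ∃ M : ℝ, ∀ᶠ n in atTop, P n {ω | M < ‖Y n ω‖} ≤ ENNReal.ofReal ε

/-- `Yₙ → c` in probability, where `Yₙ` lives on the `n`-th probability space. -/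
def TendstoInProb {Ω : ℕ → Type*} [∀ n, MeasurableSpace (Ω n)]
    (P : ∀ n, Measure (Ω n)) (Y : ∀ n, Ω n → ℝ) (c : ℝ) : Prop :=
  ∀ ε : ℝ, 0 < ε → Tendsto (fun n => P n {ω | ε < |Y n ω - c|}) atTop (𝓝 0)

/-- The conditional CDF at `t` of the statistic `T` given the data `X`, at the outcome `ω`, computed
from the regular conditional distribution of `T` given `X`. On `ℝ^m` the order is componentwise. -/
def condCDFGiven {Ω D E : Type*} [MeasurableSpace Ω] [MeasurableSpace D] [MeasurableSpace E]
    [StandardBorelSpace E] [Nonempty E] [Preorder E]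
    (P : Measure Ω) [IsFiniteMeasure P] (X : Ω → D) (T : Ω → E) (t : E) (ω : Ω) : ℝ :=
  (condDistrib T X P (X ω)).real (Set.Iic t)

/-- Conditionally on the data, the CDF of `Tₙ` converges pointwise in probability to that of `ν`. -/
def CondCDFTendsto {Ω D : ℕ → Type*} [∀ n, MeasurableSpace (Ω n)] [∀ n, MeasurableSpace (D n)]
    {E : Type*} [MeasurableSpace E] [StandardBorelSpace E] [Nonempty E] [Preorder E]
    (P : ∀ n, Measure (Ω n)) [∀ n, IsProbabilityMeasure (P n)]
    (X : ∀ n, Ω n → D n) (T : ∀ n, Ω n → E) (ν : Measure E) : Prop :=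
  ∀ t : E, TendstoInProb P (fun n ω => condCDFGiven (P n) (X n) (T n) t ω) (ν.real (Set.Iic t))

/-- Conditionally on the data, the CDF of `Tₙ` converges uniformly in probability to that
of `ν`. -/
def CondCDFTendstoUniformly {Ω D : ℕ → Type*} [∀ n, MeasurableSpace (Ω n)]
    [∀ n, MeasurableSpace (D n)]
    (P : ∀ n, Measure (Ω n)) [∀ n, IsProbabilityMeasure (P n)]
    (X : ∀ n, Ω n → D n) (T : ∀ n, Ω n → ℝ) (ν : Measure ℝ) : Prop :=
  TendstoInProb P
    (fun n ω => ⨆ t : ℝ, |condCDFGiven (P n) (X n) (T n) t ω - ν.real (Set.Iic t)|) 0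

end Convergence

end Resampling

end

/-
Given the data, the statistics are normalized sums of `R` i.i.d. draws from a finite law, namely the
image of the uniform law on permutations, so a triangular central limit theorem applies. An
argument along subsequences reduces convergence in probability to nonrandom data sets with
bounded centring error, bounded `p`-th moments and convergent sample variance, where `p = 2 + δ`.

After multiplication by `Σ̂^{-1/2}` the permutation moments are explicit. Let `z̄ = O(n^{-1/2})` be
the mean of the standardized data `zᵢ`. A single draw has mean `z̄` and second moment `I + z̄ z̄'`,
so the bias `√R z̄` vanishes as soon as `R / n → 0`. For a pair of distinct draws,
`∑_{i ≠ j} zᵢ'zⱼ = n² |z̄|² - ∑ᵢ |zᵢ|²` is only `O(n)`, so `zᵢ'zⱼ` has mean `O(1 / n)` and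
`√R / n → 0` suffices; its second moment tends to `m`, as the diagonal contributes at most
`maxᵢ |zᵢ|² ∑ᵢ |zᵢ|² = O(n^{1 + 2/p}) = o(n²)` to the sum over all pairs. Bounded `p`-th moments
with `p > 2` give Lyapunov's condition. The vector case follows by the Cramér–Wold device, the
chi-square limit by continuous mapping, and uniformity in `t` by Pólya's theorem.
-/

noncomputable section

namespace Resampling

section CentralLimit

open Matrix Asymptotics

lemma norm_exp_mul_I_sub_taylor_le {p : ℝ} (hp2 : 2 ≤ p) (hp3 : p ≤ 3) (x : ℝ) :
    ‖Complex.exp (x * Complex.I) - (1 + x * Complex.I - x ^ 2 / 2)‖ ≤ 4 * |x| ^ p := by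
  rcases le_or_gt |x| 1 with hx | hx
  · have hsum : ∑ j ∈ Finset.range 3, (x * Complex.I : ℂ) ^ j / j.factorial
        = 1 + x * Complex.I - x ^ 2 / 2 := by
      simp [Finset.sum_range_succ, Nat.factorial, mul_pow]; ring
    have hexp : Real.exp |x| ≤ 4 := by
      linarith [Real.exp_le_exp.2 hx, Real.exp_one_lt_d9]
    have hpow : |x| ^ 3 ≤ |x| ^ p := by
      rw [← Real.rpow_natCast |x| 3]
      exact Real.rpow_le_rpow_of_exponent_ge_of_imp (abs_nonneg x) hx (by exact_mod_cast hp3)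
        (by norm_num)
    calc _ ≤ ‖(x * Complex.I : ℂ)‖ ^ 3 * Real.exp ‖(x * Complex.I : ℂ)‖ := by
          rw [← hsum]; exact Complex.norm_exp_sub_sum_le_norm_mul_exp _ 3
      _ = |x| ^ 3 * Real.exp |x| := by simp
      _ ≤ |x| ^ p * 4 := by gcongr
      _ = 4 * |x| ^ p := mul_comm _ _
  · have hpow : |x| ^ 2 ≤ |x| ^ p := by
      rw [← Real.rpow_natCast |x| 2]
      exact Real.rpow_le_rpow_of_exponent_le hx.le (by exact_mod_cast hp2)
    calc _ ≤ ‖Complex.exp (x * Complex.I)‖ + (‖(1 : ℂ)‖ + ‖(x * Complex.I : ℂ)‖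
            + ‖(x ^ 2 / 2 : ℂ)‖) :=
          (norm_sub_le _ _).trans
            (add_le_add_right ((norm_sub_le _ _).trans (add_le_add_left (norm_add_le _ _) _)) _)
      _ = 1 + (1 + |x| + |x| ^ 2 / 2) := by
          rw [Complex.norm_exp_ofReal_mul_I]; simp
      _ ≤ 4 * |x| ^ 2 := by nlinarith
      _ ≤ _ := by gcongr

lemma tendsto_one_add_pow_exp {ι : Type*} {l : Filter ι} {N : ι → ℕ} {g : ι → ℂ} {z : ℂ}
    (hN : Tendsto N l atTop) (hg : Tendsto (fun i => N i * g i) l (𝓝 z)) :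
    Tendsto (fun i => (1 + g i) ^ N i) l (𝓝 (Complex.exp z)) := by
  have hNr : Tendsto (fun i => (N i : ℝ)) l atTop := tendsto_natCast_atTop_atTop.comp hN
  have hg0 : Tendsto g l (𝓝 0) := by
    have hinv : Tendsto (fun i => (N i : ℂ)⁻¹) l (𝓝 0) := by
      simpa [Function.comp_def] using
        (Complex.continuous_ofReal.tendsto 0).comp (tendsto_inv_atTop_zero.comp hNr)
    refine (by simpa using hinv.mul hg : Tendsto _ l (𝓝 (0 : ℂ))).congr' ?_
    filter_upwards [hN.eventually_ne_atTop 0] with i hi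
    exact inv_mul_cancel_left₀ (Nat.cast_ne_zero.2 hi) _
  have hlog : Tendsto (fun i => N i * Complex.log (1 + g i)) l (𝓝 z) := by
    have hO : (fun i => N i * (Complex.log (1 + g i) - g i)) =O[l] fun i => N i * g i * g i := by
      simpa only [Function.comp_def, sq, mul_assoc] using
        (isBigO_refl (fun i => (N i : ℂ)) l).mul (Complex.log_sub_self_isBigO.comp_tendsto hg0)
    have h0 := hO.trans_tendsto (by simpa using hg.mul hg0)
    simpa [mul_sub] using h0.add hg
  refine ((Complex.continuous_exp.tendsto z).comp hlog).congr' ?_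
  filter_upwards [hg0.eventually_ne (neg_ne_zero.2 one_ne_zero).symm] with i hi
  have hne : 1 + g i ≠ 0 := fun h => hi (eq_neg_of_add_eq_zero_right h)
  rw [Function.comp_apply, Complex.exp_nat_mul, Complex.exp_log hne]

lemma norm_charFun_map_sub_taylor_le {G : Type*} [MeasurableSpace G] {ν : Measure G}
    [IsProbabilityMeasure ν] {W : G → ℝ} {p : ℝ} (hp2 : 2 ≤ p) (hp3 : p ≤ 3)
    (hW : MemLp W (.ofReal p) ν) (s : ℝ) :
    ‖charFun (ν.map W) s - (1 + (s * ∫ g, W g ∂ν : ℝ) * Complex.I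
        - (s ^ 2 * ∫ g, W g ^ 2 ∂ν : ℝ) / 2)‖ ≤ 4 * (|s| ^ p * ∫ g, |W g| ^ p ∂ν) := by
  have hint1 : Integrable (fun g => s * W g) ν :=
    (hW.integrable (by simpa using (by linarith : 1 ≤ p))).const_mul s
  have hint2 : Integrable (fun g => (s * W g) ^ 2) ν :=
    ((hW.mono_exponent (by simpa using hp2)).const_mul s).integrable_sq
  have hintp : Integrable (fun g => |W g| ^ p) ν := by
    simpa [ENNReal.toReal_ofReal (by linarith : 0 ≤ p)] using hW.integrable_norm_rpow'
  have hexp : Integrable (fun g => Complex.exp ((s * W g : ℝ) * Complex.I)) ν :=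
    Integrable.of_bound (C := 1)
      (by have := hW.aestronglyMeasurable.aemeasurable
          exact AEMeasurable.aestronglyMeasurable (by fun_prop))
      (ae_of_all _ fun g => (Complex.norm_exp_ofReal_mul_I _).le)
  have hpoly : Integrable
      (fun g => (1 + (s * W g : ℝ) * Complex.I - ((s * W g) ^ 2 : ℝ) / 2 : ℂ)) ν :=
    ((integrable_const _).add (hint1.ofReal.mul_const _)).sub (hint2.ofReal.div_const _)
  have htaylor : (1 + (s * ∫ g, W g ∂ν : ℝ) * Complex.I - (s ^ 2 * ∫ g, W g ^ 2 ∂ν : ℝ) / 2 : ℂ)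
      = ∫ g, (1 + (s * W g : ℝ) * Complex.I - ((s * W g) ^ 2 : ℝ) / 2 : ℂ) ∂ν := by
    rw [integral_sub ((integrable_const _).add (hint1.ofReal.mul_const _))
      (hint2.ofReal.div_const _), integral_add (integrable_const _) (hint1.ofReal.mul_const _),
      integral_mul_const, integral_div, integral_const, integral_complex_ofReal,
      integral_complex_ofReal]
    simp [mul_pow, integral_const_mul]
  have hchar : charFun (ν.map W) s = ∫ g, Complex.exp ((s * W g : ℝ) * Complex.I) ∂ν := by
    rw [charFun_apply_real, integral_map hW.aestronglyMeasurable.aemeasurable (by fun_prop)]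
    simp
  rw [hchar, htaylor, ← integral_sub hexp hpoly, ← integral_const_mul, ← integral_const_mul]
  refine norm_integral_le_of_norm_le ((hintp.const_mul _).const_mul _) (ae_of_all _ fun g => ?_)
  rw [← Real.mul_rpow (abs_nonneg _) (abs_nonneg _), ← abs_mul]
  simpa using norm_exp_mul_I_sub_taylor_le hp2 hp3 (s * W g)

lemma charFun_map_sum_pi {ι G : Type*} [Fintype ι] [MeasurableSpace G] {ν : Measure G}
    [IsProbabilityMeasure ν] {W : G → ℝ} (hW : AEMeasurable W ν) (s : ℝ) :
    charFun ((Measure.pi fun _ : ι => ν).map fun g => ∑ i, W (g i)) s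
      = charFun (ν.map W) s ^ Fintype.card ι := by
  have : IsProbabilityMeasure (ν.map W) := Measure.isProbabilityMeasure_map hW
  have hmp : ∀ i : ι, AEMeasurable (fun g : ι → G => W (g i)) (Measure.pi fun _ : ι => ν) :=
    fun i => hW.comp_quasiMeasurePreserving (Measure.quasiMeasurePreserving_eval _ i)
  have hsum : ((Measure.pi fun _ : ι => ν).map fun g => ∑ i, W (g i))
      = (Measure.pi fun _ : ι => ν.map W).map fun w => ∑ i, w i := by
    rw [← Measure.pi_map_pi fun _ => hW, AEMeasurable.map_map_of_aemeasurable (by fun_prop)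
      (aemeasurable_pi_lambda _ hmp)]
    rfl
  rw [hsum, charFun_map_sum_pi_eq_prod]
  simp

section Lyapunov

variable {G : ℕ → Type*} [∀ k, MeasurableSpace (G k)] {ν : ∀ k, Measure (G k)}
  [∀ k, IsProbabilityMeasure (ν k)] {R : ℕ → ℕ} {p v C : ℝ}

lemma mul_abs_inv_sqrt_rpow {r : ℝ} (hr : 0 < r) (p : ℝ) :
    r * |(√r)⁻¹| ^ p = r ^ (-(p / 2 - 1)) := by
  rw [abs_of_nonneg (by positivity), Real.sqrt_eq_rpow, ← Real.rpow_neg hr.le,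
    ← Real.rpow_mul hr.le]
  nth_rewrite 1 [← Real.rpow_one r]
  rw [← Real.rpow_add hr]
  ring_nf

lemma tendsto_natCast_mul_charFun_map_sub_one {W : ∀ k, G k → ℝ} (hR : Tendsto R atTop atTop)
    (hp2 : 2 < p) (hp3 : p ≤ 3) (hW : ∀ k, MemLp (W k) (.ofReal p) (ν k))
    (hmean : Tendsto (fun k => √(R k : ℝ) * ∫ g, W k g ∂ν k) atTop (𝓝 0))
    (hvar : Tendsto (fun k => ∫ g, W k g ^ 2 ∂ν k) atTop (𝓝 v))
    (hmom : ∀ᶠ k in atTop, ∫ g, |W k g| ^ p ∂ν k ≤ C) :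
    Tendsto (fun k => R k * (charFun ((ν k).map (W k)) (√(R k : ℝ))⁻¹ - 1)) atTop
      (𝓝 (-(v / 2 : ℝ))) := by
  have hRr : Tendsto (fun k => (R k : ℝ)) atTop atTop := tendsto_natCast_atTop_atTop.comp hR
  set A : ℕ → ℝ := fun k => ∫ g, W k g ∂ν k
  set V : ℕ → ℝ := fun k => ∫ g, W k g ^ 2 ∂ν k
  have hmain : Tendsto (fun k => ((√(R k : ℝ) * A k : ℝ) * Complex.I - (V k / 2 : ℝ) : ℂ)) atTop
      (𝓝 (-(v / 2 : ℝ))) := by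
    simpa using ((Complex.continuous_ofReal.tendsto 0).comp hmean |>.mul_const Complex.I).sub
      ((Complex.continuous_ofReal.tendsto _).comp (hvar.div_const 2))
  have hbound : ∀ᶠ k in atTop, ‖R k * (charFun ((ν k).map (W k)) (√(R k : ℝ))⁻¹ - 1)
      - ((√(R k : ℝ) * A k : ℝ) * Complex.I - (V k / 2 : ℝ) : ℂ)‖
      ≤ 4 * (C * (R k : ℝ) ^ (-(p / 2 - 1))) := by
    filter_upwards [hRr.eventually_gt_atTop 0, hmom] with k hk hm
    set r : ℝ := (R k : ℝ) with hr
    have hA : r * ((√r)⁻¹ * A k) = √r * A k := by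
      rw [← mul_assoc, ← div_eq_mul_inv, Real.div_sqrt]
    have hV : r * ((√r)⁻¹ ^ 2 * V k) = V k := by
      rw [inv_pow, Real.sq_sqrt hk.le, mul_inv_cancel_left₀ hk.ne']
    calc _ = ‖(r : ℂ) * (charFun ((ν k).map (W k)) (√r)⁻¹
            - (1 + ((√r)⁻¹ * A k : ℝ) * Complex.I - ((√r)⁻¹ ^ 2 * V k : ℝ) / 2))‖ := by
          rw [← hA, show V k / 2 = r * ((√r)⁻¹ ^ 2 * V k) / 2 by rw [hV]]
          congr 1; push_cast [hr]; ring
      _ = r * ‖charFun ((ν k).map (W k)) (√r)⁻¹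
            - (1 + ((√r)⁻¹ * A k : ℝ) * Complex.I - ((√r)⁻¹ ^ 2 * V k : ℝ) / 2)‖ := by
          rw [norm_mul, Complex.norm_of_nonneg hk.le]
      _ ≤ r * (4 * (|(√r)⁻¹| ^ p * C)) := by
          gcongr
          exact (norm_charFun_map_sub_taylor_le hp2.le hp3 (hW k) _).trans (by gcongr)
      _ = 4 * (C * r ^ (-(p / 2 - 1))) := by rw [← mul_abs_inv_sqrt_rpow hk]; ring
  have herr : Tendsto (fun k => 4 * (C * (R k : ℝ) ^ (-(p / 2 - 1)))) atTop (𝓝 0) := by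
    simpa using (((tendsto_rpow_neg_atTop (by linarith : 0 < p / 2 - 1)).comp hRr).const_mul
      C).const_mul 4
  simpa using (squeeze_zero_norm' hbound herr).add hmain

lemma tendsto_charFun_map_inv_sqrt_pow {W : ∀ k, G k → ℝ} (hR : Tendsto R atTop atTop)
    (hp : 2 < p) (hW : ∀ k, MemLp (W k) (.ofReal p) (ν k))
    (hmean : Tendsto (fun k => √(R k : ℝ) * ∫ g, W k g ∂ν k) atTop (𝓝 0))
    (hvar : Tendsto (fun k => ∫ g, W k g ^ 2 ∂ν k) atTop (𝓝 v))
    (hmom : ∀ᶠ k in atTop, ∫ g, |W k g| ^ p ∂ν k ≤ C) :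
    Tendsto (fun k => charFun ((ν k).map (W k)) (√(R k : ℝ))⁻¹ ^ R k) atTop
      (𝓝 (Complex.exp (-(v / 2 : ℝ)))) := by
  -- The third-order Taylor remainder controls exponents up to `3`, so `p` is truncated there.
  have hWq : ∀ k, MemLp (W k) (.ofReal (min p 3)) (ν k) := fun k =>
    (hW k).mono_exponent (ENNReal.ofReal_le_ofReal (min_le_left _ _))
  have hmom' : ∀ᶠ k in atTop, ∫ g, |W k g| ^ min p 3 ∂ν k ≤ 1 + C := by
    filter_upwards [hmom] with k hk
    have hint : ∀ {q : ℝ}, 0 ≤ q → MemLp (W k) (.ofReal q) (ν k) →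
        Integrable (fun g => |W k g| ^ q) (ν k) := fun hq h => by
      simpa [ENNReal.toReal_ofReal hq] using h.integrable_norm_rpow'
    have hintp := hint (by linarith) (hW k)
    calc ∫ g, |W k g| ^ min p 3 ∂ν k ≤ ∫ g, 1 + |W k g| ^ p ∂ν k := by
          refine integral_mono (hint (by positivity) (hWq k)) ((integrable_const 1).add hintp)
            fun g => ?_
          rcases le_total |W k g| 1 with h | h
          · have := Real.rpow_le_one (abs_nonneg (W k g)) h (by positivity : 0 ≤ min p 3)
            have := Real.rpow_nonneg (abs_nonneg (W k g)) p
            simp only; linarith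
          · exact (Real.rpow_le_rpow_of_exponent_le h (min_le_left p 3)).trans (by simp)
      _ = 1 + ∫ g, |W k g| ^ p ∂ν k := by rw [integral_add (integrable_const 1) hintp]; simp
      _ ≤ 1 + C := by gcongr
  simpa using tendsto_one_add_pow_exp hR (tendsto_natCast_mul_charFun_map_sub_one hR
    (lt_min hp (by norm_num)) (min_le_right p 3) hWq hmean hvar hmom')

theorem tendstoInDistribution_inv_sqrt_mul_sum_pi {Θ : Type*} [MeasurableSpace Θ]
    {Q : Measure Θ} [IsProbabilityMeasure Q] {Y : Θ → ℝ} {v : NNReal}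
    (hY : HasLaw Y (gaussianReal 0 v) Q) {W : ∀ k, G k → ℝ} (hR : Tendsto R atTop atTop)
    (hp : 2 < p) (hW : ∀ k, MemLp (W k) (.ofReal p) (ν k))
    (hmean : Tendsto (fun k => √(R k : ℝ) * ∫ g, W k g ∂ν k) atTop (𝓝 0))
    (hvar : Tendsto (fun k => ∫ g, W k g ^ 2 ∂ν k) atTop (𝓝 v))
    (hmom : ∀ᶠ k in atTop, ∫ g, |W k g| ^ p ∂ν k ≤ C) :
    TendstoInDistribution (fun k (g : Fin (R k) → G k) => (√(R k : ℝ))⁻¹ * ∑ r, W k (g r)) atTop Y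
      (fun k => Measure.pi fun _ => ν k) Q := by
  have hae : ∀ k, AEMeasurable (W k) (ν k) := fun k => (hW k).aestronglyMeasurable.aemeasurable
  have hsum : ∀ k, AEMeasurable (fun g : Fin (R k) → G k => ∑ r, W k (g r))
      (Measure.pi fun _ => ν k) := fun k => Finset.aemeasurable_fun_sum _ fun r _ =>
    (hae k).comp_quasiMeasurePreserving (Measure.quasiMeasurePreserving_eval _ r)
  refine ⟨fun k => (hsum k).const_mul _, hY.aemeasurable,
    ProbabilityMeasure.tendsto_of_tendsto_charFun fun s => ?_⟩
  have hchar : ∀ k, charFun ((Measure.pi fun _ : Fin (R k) => ν k).map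
      fun g => (√(R k : ℝ))⁻¹ * ∑ r, W k (g r)) s
        = charFun ((ν k).map fun g => s * W k g) (√(R k : ℝ))⁻¹ ^ R k := fun k => by
    rw [charFun_map_mul_comp (hsum k), charFun_map_sum_pi (hae k), charFun_map_mul_comp (hae k),
      Fintype.card_fin, mul_comm]
  have hlim := tendsto_charFun_map_inv_sqrt_pow (v := s ^ 2 * v) (C := |s| ^ p * C) hR hp
    (fun k => (hW k).const_mul s)
    (by simpa [integral_const_mul, mul_left_comm] using hmean.const_mul s)
    (by simpa [mul_pow, integral_const_mul] using hvar.const_mul (s ^ 2))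
    (hmom.mono fun k hk => by
      simp only [abs_mul, Real.mul_rpow (abs_nonneg _) (abs_nonneg _), integral_const_mul]
      gcongr)
  simp only [ProbabilityMeasure.coe_mk, hY.map_eq, hchar, charFun_gaussianReal]
  convert hlim using 3
  push_cast; ring

end Lyapunov

lemma charFun_map_toLp {Θ : Type*} [MeasurableSpace Θ] {Q : Measure Θ} {m : ℕ}
    {Y : Θ → Fin m → ℝ} (hY : AEMeasurable Y Q) (t : EuclideanSpace ℝ (Fin m)) :
    charFun (Q.map fun θ => WithLp.toLp 2 (Y θ)) t
      = charFun (Q.map fun θ => WithLp.ofLp t ⬝ᵥ Y θ) 1 := by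
  rw [charFun_apply, charFun_apply_real, integral_map (by fun_prop) (by fun_prop),
    integral_map (by unfold dotProduct; fun_prop) (by fun_prop)]
  simp [EuclideanSpace.inner_eq_star_dotProduct]

lemma tendstoInDistribution_of_dotProduct {Ω : ℕ → Type*} [∀ k, MeasurableSpace (Ω k)]
    {P : ∀ k, Measure (Ω k)} [∀ k, IsProbabilityMeasure (P k)] {m : ℕ}
    {Z : ∀ k, Ω k → Fin m → ℝ} {ν : Measure (Fin m → ℝ)} [IsProbabilityMeasure ν]
    (h : ∀ t : Fin m → ℝ,
      TendstoInDistribution (fun k ω => t ⬝ᵥ Z k ω) atTop (fun z => t ⬝ᵥ z) P ν) :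
    TendstoInDistribution Z atTop id P ν := by
  have hZ : ∀ k, AEMeasurable (Z k) (P k) := fun k => aemeasurable_pi_lambda _ fun i => by
    simpa using (h (Pi.single i 1)).forall_aemeasurable k
  have hE : TendstoInDistribution (fun k ω => WithLp.toLp 2 (Z k ω)) atTop
      (fun z : Fin m → ℝ => WithLp.toLp 2 z) P ν := by
    have := hZ
    refine ⟨fun k => by fun_prop, by fun_prop,
      ProbabilityMeasure.tendsto_of_tendsto_charFun fun t => ?_⟩
    simp only [ProbabilityMeasure.coe_mk]
    rw [charFun_map_toLp aemeasurable_id']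
    simp only [charFun_map_toLp (hZ _)]
    exact ProbabilityMeasure.tendsto_iff_tendsto_charFun.1 (h t).tendsto 1
  exact hE.continuous_comp (g := WithLp.ofLp) (by fun_prop)

lemma stdNormal_map_dotProduct {m : ℕ} (t : Fin m → ℝ) :
    (stdNormal m).map (fun z => t ⬝ᵥ z) = gaussianReal 0 (t ⬝ᵥ t).toNNReal := by
  have hmeas : Measurable fun z : Fin m → ℝ => t ⬝ᵥ z := Continuous.measurable (by fun_prop)
  have := Measure.isProbabilityMeasure_map (μ := stdNormal m) hmeas.aemeasurable
  refine Measure.ext_of_charFun (funext fun s => ?_)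
  have hvec := charFun_map_toLp (Q := stdNormal m) aemeasurable_id' (WithLp.toLp 2 (s • t))
  have hs : (fun z : Fin m → ℝ => (s • t) ⬝ᵥ z) = fun z => s * t ⬝ᵥ z := by simp
  rw [hs, charFun_map_mul_comp hmeas.aemeasurable, mul_one] at hvec
  rw [← hvec, stdNormal, map_pi_eq_stdGaussian, charFun_stdGaussian, charFun_gaussianReal,
    ← Complex.ofReal_pow, EuclideanSpace.real_norm_sq_eq,
    Real.coe_toNNReal _ (by simpa using dotProduct_star_self_nonneg t)]
  simp [dotProduct, mul_pow, ← Finset.mul_sum, ← sq]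
  ring_nf

theorem tendstoInDistribution_inv_sqrt_smul_sum_pi {G : ℕ → Type*} [∀ k, MeasurableSpace (G k)]
    {ν : ∀ k, Measure (G k)} [∀ k, IsProbabilityMeasure (ν k)] {R : ℕ → ℕ} {p : ℝ}
    {m : ℕ} {W : ∀ k, G k → Fin m → ℝ} (hR : Tendsto R atTop atTop) (hp : 2 < p)
    (hW : ∀ t k, MemLp (fun g => t ⬝ᵥ W k g) (.ofReal p) (ν k))
    (hmean : ∀ t, Tendsto (fun k => √(R k : ℝ) * ∫ g, t ⬝ᵥ W k g ∂ν k) atTop (𝓝 0))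
    (hvar : ∀ t, Tendsto (fun k => ∫ g, (t ⬝ᵥ W k g) ^ 2 ∂ν k) atTop (𝓝 (t ⬝ᵥ t)))
    (hmom : ∀ t, ∃ C, ∀ᶠ k in atTop, ∫ g, |t ⬝ᵥ W k g| ^ p ∂ν k ≤ C) :
    TendstoInDistribution (fun k (g : Fin (R k) → G k) => (√(R k : ℝ))⁻¹ • ∑ r, W k (g r)) atTop id
      (fun k => Measure.pi fun _ => ν k) (stdNormal m) := by
  refine tendstoInDistribution_of_dotProduct fun t => ?_
  obtain ⟨C, hC⟩ := hmom t
  have hlaw : HasLaw (fun z => t ⬝ᵥ z) (gaussianReal 0 (t ⬝ᵥ t).toNNReal) (stdNormal m) :=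
    ⟨Continuous.aemeasurable (by fun_prop), stdNormal_map_dotProduct t⟩
  have htt : ((t ⬝ᵥ t).toNNReal : ℝ) = t ⬝ᵥ t :=
    Real.coe_toNNReal _ (by simpa using dotProduct_star_self_nonneg t)
  simpa only [dotProduct_smul, dotProduct_sum, smul_eq_mul] using
    tendstoInDistribution_inv_sqrt_mul_sum_pi hlaw hR hp (hW t) (hmean t)
      (by rw [htt]; exact hvar t) hC

end CentralLimit

section DistributionFunctions

open Set

lemma exists_finset_forall_sub_le {F : ℝ → ℝ} (hF : Continuous F) (hmono : Monotone F)
    (hbot : Tendsto F atBot (𝓝 0)) (htop : Tendsto F atTop (𝓝 1)) {ε : ℝ} (hε : 0 < ε) :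
    ∃ s : Finset ℝ, ∀ G : ℝ → ℝ, Monotone G → (∀ t, 0 ≤ G t) → (∀ a ∈ s, F a - ε ≤ G a) →
      ∀ t, F t - 2 * ε ≤ G t := by
  have hsurj : ∀ u, ∃ a, 0 < u → u < 1 → F a = u := fun u => by
    by_cases hu : 0 < u ∧ u < 1
    · obtain ⟨a, ha⟩ := mem_range_of_exists_le_of_exists_ge hF
        (hbot.eventually_le_const hu.1).exists (htop.eventually_const_le hu.2).exists
      exact ⟨a, fun _ _ => ha⟩
    · exact ⟨0, fun h0 h1 => (hu ⟨h0, h1⟩).elim⟩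
  choose q hq using hsurj
  obtain ⟨N, hN⟩ := exists_nat_gt ε⁻¹
  have hN0 : (0 : ℝ) < N := (inv_pos.2 hε).trans hN
  have hNε : 1 < N * ε := by rwa [inv_lt_iff_one_lt_mul₀ hε] at hN
  refine ⟨(Finset.range N).image fun j : ℕ => q (j / N), fun G hG hG0 hGs t => ?_⟩
  rcases le_or_gt (F t) ε with ht | ht
  · linarith [hG0 t]
  obtain ⟨j, hj⟩ : ∃ j, ⌈N * F t⌉₊ = j + 1 :=
    Nat.exists_eq_add_one.2 (Nat.ceil_pos.2 (mul_pos hN0 (hε.trans ht)))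
  have hlt : (j : ℝ) < N * F t := Nat.lt_ceil.1 (by omega)
  have hle : N * F t ≤ j + 1 := by exact_mod_cast hj ▸ Nat.le_ceil (N * F t)
  have hjN : (j : ℝ) < N :=
    hlt.trans_le (mul_le_of_le_one_right hN0.le (hmono.ge_of_tendsto htop t))
  have hj0 : (0 : ℝ) < j := by nlinarith
  have hFq : F (q (j / N)) = j / N := hq _ (by positivity) ((div_lt_one hN0).2 hjN)
  have hqt : q (j / N) ≤ t := (hmono.reflect_lt (by rwa [hFq, div_lt_iff₀' hN0])).le
  calc F t - 2 * ε ≤ (j + 1) / N - 2 * ε := by gcongr; rwa [le_div_iff₀' hN0]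
    _ ≤ j / N - ε := by
        have : 1 / (N : ℝ) ≤ ε := by rw [div_le_iff₀' hN0]; exact hNε.le
        rw [add_div]; linarith
    _ ≤ G (q (j / N)) := by
        have := hGs _ (Finset.mem_image_of_mem _ (Finset.mem_range.2 (Nat.cast_lt.1 hjN)))
        rwa [hFq] at this
    _ ≤ G t := hG hqt

lemma exists_finset_forall_abs_sub_le {F : ℝ → ℝ} (hF : Continuous F) (hmono : Monotone F)
    (hbot : Tendsto F atBot (𝓝 0)) (htop : Tendsto F atTop (𝓝 1)) {ε : ℝ} (hε : 0 < ε) :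
    ∃ s : Finset ℝ, ∀ G : ℝ → ℝ, Monotone G → (∀ t, 0 ≤ G t) → (∀ t, G t ≤ 1) →
      (∀ a ∈ s, |G a - F a| ≤ ε) → ∀ t, |G t - F t| ≤ 2 * ε := by
  obtain ⟨s, hs⟩ := exists_finset_forall_sub_le hF hmono hbot htop hε
  obtain ⟨s', hs'⟩ := exists_finset_forall_sub_le (F := fun t => 1 - F (-t))
    (by fun_prop) (fun a b hab => sub_le_sub_left (hmono (neg_le_neg hab)) 1)
    (by simpa using (htop.comp tendsto_neg_atBot_atTop).const_sub 1)
    (by simpa using (hbot.comp tendsto_neg_atTop_atBot).const_sub 1) hε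
  refine ⟨s ∪ s'.image (- ·), fun G hG hG0 hG1 hGs t => abs_le.2 ⟨?_, ?_⟩⟩
  · linarith [hs G hG hG0 (fun a ha => by
      linarith [abs_le.1 (hGs a (Finset.mem_union_left _ ha))]) t]
  · have := hs' (fun t => 1 - G (-t)) (fun a b hab => sub_le_sub_left (hG (neg_le_neg hab)) 1)
      (fun t => sub_nonneg.2 (hG1 _)) (fun a ha => by
        linarith [abs_le.1 (hGs (-a)
          (Finset.mem_union_right _ (Finset.mem_image_of_mem _ ha)))]) (-t)
    simp only [neg_neg] at this
    linarith

lemma continuous_cdf (ν : Measure ℝ) [IsProbabilityMeasure ν] [NullSingletonClass ν] :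
    Continuous (cdf ν) := by
  rw [continuous_iff_continuousAt]
  intro c
  rw [(monotone_cdf ν).continuousAt_iff_leftLim_eq_rightLim, StieltjesFunction.rightLim_eq]
  have h := (cdf ν).measure_singleton c
  rw [measure_cdf, measure_singleton, eq_comm, ENNReal.ofReal_eq_zero] at h
  exact le_antisymm ((monotone_cdf ν).leftLim_le le_rfl) (by linarith)

lemma continuousAt_measureReal_of_null_frontier {E : Type*} [TopologicalSpace E]
    [MeasurableSpace E] [OpensMeasurableSpace E] [HasOuterApproxClosed E] {ν : ProbabilityMeasure E}
    {s : Set E} (hs : (ν : Measure E) (frontier s) = 0) :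
    ContinuousAt (fun ρ : ProbabilityMeasure E => (ρ : Measure E).real s) ν :=
  (ENNReal.tendsto_toReal (measure_ne_top _ _)).comp
    (ProbabilityMeasure.tendsto_measure_of_null_frontier_of_tendsto' tendsto_id hs)

theorem continuousAt_iSup_abs_sub_measureReal_Iic (ν : ProbabilityMeasure ℝ)
    [NullSingletonClass (ν : Measure ℝ)] :
    ContinuousAt (fun ρ : ProbabilityMeasure ℝ =>
      ⨆ t : ℝ, |(ρ : Measure ℝ).real (Iic t) - (ν : Measure ℝ).real (Iic t)|) ν := by
  rw [Metric.continuousAt_iff']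
  intro ε hε
  obtain ⟨s, hs⟩ := exists_finset_forall_abs_sub_le (continuous_cdf (ν : Measure ℝ))
    (monotone_cdf _) (tendsto_cdf_atBot _) (tendsto_cdf_atTop _) (by positivity : 0 < ε / 4)
  simp only [cdf_eq_real] at hs
  have hgrid : ∀ᶠ ρ : ProbabilityMeasure ℝ in 𝓝 ν, ∀ a ∈ s,
      |(ρ : Measure ℝ).real (Iic a) - (ν : Measure ℝ).real (Iic a)| ≤ ε / 4 :=
    (Finset.eventually_all s).2 fun a _ =>
      (continuousAt_measureReal_of_null_frontier (by rw [frontier_Iic]; exact measure_singleton a)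
        (Metric.closedBall_mem_nhds _ (by positivity)))
  filter_upwards [hgrid] with ρ hρ
  have hbound := hs (fun t => (ρ : Measure ℝ).real (Iic t))
    (fun a b hab => measureReal_mono (Iic_subset_Iic.2 hab)) (fun _ => measureReal_nonneg)
    (fun _ => measureReal_le_one) hρ
  simp only [sub_self, abs_zero, ciSup_const, dist_zero_right, Real.norm_eq_abs]
  rw [abs_of_nonneg (Real.iSup_nonneg fun t => abs_nonneg _)]
  exact (ciSup_le hbound).trans_lt (by linarith)

lemma stdNormal_eval_eq {m : ℕ} (i : Fin m) (c : ℝ) : stdNormal m {z | z i = c} = 0 := by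
  have := nullSingletonClass_gaussianReal (μ := 0) (one_ne_zero : (1 : NNReal) ≠ 0)
  exact ((measurePreserving_eval (fun _ : Fin m => gaussianReal 0 1) i).measure_preimage
    (measurableSet_singleton c).nullMeasurableSet).trans (measure_singleton c)

lemma stdNormal_frontier_Iic {m : ℕ} (t : Fin m → ℝ) : stdNormal m (frontier (Iic t)) = 0 := by
  refine measure_mono_null (fun z hz => ?_)
    (measure_iUnion_null fun i => stdNormal_eval_eq i (t i))
  rw [isClosed_Iic.frontier_eq] at hz
  by_contra hne
  simp only [mem_iUnion, mem_ofPred_eq, not_exists] at hne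
  exact hz.2 (mem_interior.2 ⟨univ.pi fun i => Iio (t i), fun y hy i => (hy i (mem_univ i)).le,
    isOpen_set_pi finite_univ fun i _ => isOpen_Iio, fun i _ => (hz.1 i).lt_of_ne (hne i)⟩)

lemma nullSingletonClass_chiSquare {m : ℕ} (hm : 0 < m) : NullSingletonClass (chiSquare m) := by
  have := nullSingletonClass_gaussianReal (μ := 0) (one_ne_zero : (1 : NNReal) ≠ 0)
  obtain ⟨m, rfl⟩ := Nat.exists_eq_succ_of_ne_zero hm.ne'
  refine ⟨fun c => ?_⟩
  have hmeas : Measurable fun z : Fin (m + 1) → ℝ => ∑ i, z i ^ 2 := by fun_prop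
  have hs := hmeas (measurableSet_singleton c)
  have hpres := (measurePreserving_piFinSuccAbove (fun _ : Fin (m + 1) => gaussianReal 0 1) 0).symm
  rw [chiSquare, Measure.map_apply hmeas (measurableSet_singleton c), stdNormal,
    ← hpres.measure_preimage hs.nullMeasurableSet, ← Measure.prod_swap,
    Measure.map_apply measurable_swap (hpres.measurable hs),
    Measure.measure_prod_null (measurable_swap (hpres.measurable hs))]
  -- Once the other coordinates are fixed, at most two values of the first give squared norm `c`.
  refine Eventually.of_forall fun y => Set.Finite.measure_zero (Set.Finite.subset
    (toFinite {√(c - ∑ i, y i ^ 2), -√(c - ∑ i, y i ^ 2)}) fun x hx => ?_) _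
  have hx' : x ^ 2 + ∑ i, y i ^ 2 = c := by
    simpa [Fin.sum_univ_succ, MeasurableEquiv.piFinSuccAbove] using hx
  rw [← hx', add_sub_cancel_right, Real.sqrt_sq_eq_abs]
  rcases abs_choice x with h | h <;> simp [h]

end DistributionFunctions

section PermutationAverages

open Equiv

instance isProbabilityMeasure_uniformOn_perm (n : ℕ) :
    IsProbabilityMeasure (uniformOn (Set.univ : Set (Perm (Fin n)))) :=
  isProbabilityMeasure_uniformOn Set.finite_univ Set.univ_nonempty

lemma integral_uniformOn_univ {G : Type*} [Fintype G] [MeasurableSpace G]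
    [MeasurableSingletonClass G] (f : G → ℝ) :
    ∫ g, f g ∂(uniformOn (Set.univ : Set G)) = (Fintype.card G : ℝ)⁻¹ * ∑ g, f g := by
  have hfin : IsFiniteMeasure (uniformOn (Set.univ : Set G)) := by
    unfold uniformOn; infer_instance
  rw [integral_fintype .of_finite, Finset.mul_sum]
  simp [measureReal_def, uniformOn_univ]

lemma integral_smul_uniformOn_univ {G β : Type*} [Group G] [Finite G] [MeasurableSpace G]
    [MeasurableSingletonClass G] [MulAction G β] {s : Finset β} {a : β}
    (hs : (s : Set β) = MulAction.orbit G a) (f : β → ℝ) :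
    ∫ g : G, f (g • a) ∂(uniformOn (Set.univ : Set G)) = (s.card : ℝ)⁻¹ * ∑ b ∈ s, f b := by
  cases nonempty_fintype G
  have hmem : ∀ {b}, b ∈ s ↔ b ∈ MulAction.orbit G a := fun {b} => by
    rw [← hs, Finset.mem_coe]
  have hconst : ∀ b ∈ s, ∑ g : G, f (g • b) = ∑ g : G, f (g • a) := fun b hb => by
    obtain ⟨h, rfl⟩ := hmem.1 hb
    simpa [mul_smul] using Equiv.sum_comp (Equiv.mulRight h) fun g => f (g • a)
  have hinv : ∀ g : G, ∑ b ∈ s, f (g • b) = ∑ b ∈ s, f b := fun g =>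
    Finset.sum_equiv (MulAction.toPerm g) (fun b => by
      rw [hmem, hmem, MulAction.toPerm_apply, ← MulAction.orbit_eq_iff,
        ← MulAction.orbit_eq_iff, MulAction.orbit_smul]) fun _ _ => rfl
  have hcount : (s.card : ℝ) * ∑ g : G, f (g • a) = Fintype.card G * ∑ b ∈ s, f b := by
    calc (s.card : ℝ) * ∑ g : G, f (g • a) = ∑ b ∈ s, ∑ g : G, f (g • b) := by
          rw [Finset.sum_congr rfl hconst, Finset.sum_const, nsmul_eq_mul]
      _ = ∑ g : G, ∑ b ∈ s, f (g • b) := Finset.sum_comm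
      _ = _ := by simp [hinv]
  have hs0 : (s.card : ℝ) ≠ 0 := by
    exact_mod_cast (Finset.card_pos.2 ⟨a, hmem.2 (MulAction.mem_orbit_self a)⟩).ne'
  have hG : (Fintype.card G : ℝ) ≠ 0 := by exact_mod_cast Fintype.card_ne_zero
  rw [integral_uniformOn_univ]
  field_simp
  linarith

lemma coe_offDiag_eq_orbit_perm {α : Type*} [Fintype α] {a b : α} (hab : a ≠ b) :
    ((Finset.univ : Finset α).offDiag : Set (α × α)) = MulAction.orbit (Perm α) (a, b) := by
  classical
  ext ⟨c, d⟩
  simp only [Finset.mem_coe, Finset.mem_offDiag, Finset.mem_univ, true_and, MulAction.mem_orbit_iff,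
    Prod.smul_mk, Prod.mk.injEq]
  refine ⟨fun hcd => ?_, ?_⟩
  · exact MulAction.is_two_pretransitive_iff.1 (Perm.isMultiplyPretransitive α 2) hab hcd
  · rintro ⟨g, rfl, rfl⟩
    simpa using hab

variable {n m : ℕ}

lemma integral_drawn_zero (hn : 0 < n) (x : Fin n → Fin m → ℝ) (f : (Fin m → ℝ) → ℝ) :
    ∫ σ, f (drawn x σ 0) ∂(uniformOn (Set.univ : Set (Perm (Fin n))))
      = (n : ℝ)⁻¹ * ∑ i, f (x i) := by
  have horbit : ((Finset.univ : Finset (Fin n)) : Set (Fin n))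
      = MulAction.orbit (Perm (Fin n)) (⟨0, hn⟩ : Fin n) := by
    rw [MulAction.orbit_eq_univ, Finset.coe_univ]
  simpa [drawn, hn] using integral_smul_uniformOn_univ horbit fun i => f (x i)

lemma integral_drawn_zero_one (hn : 1 < n) (x : Fin n → Fin m → ℝ)
    (g : (Fin m → ℝ) → (Fin m → ℝ) → ℝ) :
    ∫ σ, g (drawn x σ 0) (drawn x σ 1) ∂(uniformOn (Set.univ : Set (Perm (Fin n))))
      = ((n : ℝ) * (n - 1))⁻¹ * ∑ i ∈ (Finset.univ : Finset (Fin n)).offDiag,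
          g (x i.1) (x i.2) := by
  have hn0 : 0 < n := by omega
  have hne : (⟨0, hn0⟩ : Fin n) ≠ ⟨1, hn⟩ := by simp
  have hcard : (((Finset.univ : Finset (Fin n)).offDiag.card : ℕ) : ℝ) = n * (n - 1) := by
    rw [Finset.offDiag_card, Nat.cast_sub (Nat.le_mul_self _), Finset.card_univ, Fintype.card_fin]
    push_cast; ring
  rw [← hcard, ← integral_smul_uniformOn_univ (coe_offDiag_eq_orbit_perm hne)]
  simp [drawn, hn, hn0]

lemma sum_offDiag_eq_sub {α : Type*} [Fintype α] (g : α → α → ℝ) :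
    ∑ x ∈ (Finset.univ : Finset α).offDiag, g x.1 x.2 = ∑ i, ∑ j, g i j - ∑ i, g i i := by
  classical
  have := Finset.sum_union (Finset.disjoint_diag_offDiag (Finset.univ : Finset α))
    (f := fun x => g x.1 x.2)
  rw [Finset.diag_union_offDiag, Finset.sum_product, Finset.sum_diag] at this
  linarith

lemma sum_offDiag_le {α : Type*} [Fintype α] {g : α → α → ℝ}
    (hg : ∀ i, 0 ≤ g i i) :
    ∑ x ∈ (Finset.univ : Finset α).offDiag, g x.1 x.2 ≤ ∑ i, ∑ j, g i j := by
  rw [sum_offDiag_eq_sub]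
  exact sub_le_self _ (Finset.sum_nonneg fun i _ => hg i)

end PermutationAverages

section SampleMoments

open Matrix

variable {n m : ℕ} (x : Fin n → Fin m → ℝ) {p C : ℝ}

lemma sum_eq_natCast_smul_sampleMean : ∑ i, x i = (n : ℝ) • sampleMean x := by
  rcases n.eq_zero_or_pos with rfl | hn
  · simp
  · rw [sampleMean, smul_inv_smul₀ (by positivity)]

lemma sum_sub_eq_natCast_smul (μ : Fin m → ℝ) :
    ∑ i, (x i - μ) = (n : ℝ) • (sampleMean x - μ) := by
  rw [Finset.sum_sub_distrib, sum_eq_natCast_smul_sampleMean, smul_sub]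
  simp [Nat.cast_smul_eq_nsmul]

lemma sum_vecMulVec_sub_sampleMean :
    ∑ i, vecMulVec (x i - sampleMean x) (x i - sampleMean x) = (n : ℝ) • sampleVar x := by
  rcases n.eq_zero_or_pos with rfl | hn
  · simp
  · rw [sampleVar, smul_inv_smul₀ (by positivity)]

lemma posSemidef_sampleVar : (sampleVar x).PosSemidef := by
  unfold sampleVar
  refine (posSemidef_sum _ fun i _ => ?_).smul (by positivity)
  simpa using posSemidef_vecMulVec_self_star (x i - sampleMean x)

lemma sum_dotProduct (t : Fin m → ℝ) : ∑ i, t ⬝ᵥ x i = n * t ⬝ᵥ sampleMean x := by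
  rw [← dotProduct_sum, sum_eq_natCast_smul_sampleMean, dotProduct_smul, smul_eq_mul]

lemma sum_dotProduct_sq (t : Fin m → ℝ) :
    ∑ i, (t ⬝ᵥ x i) ^ 2 = n * (t ⬝ᵥ sampleVar x *ᵥ t + (t ⬝ᵥ sampleMean x) ^ 2) := by
  have hcentred : ∑ i, (t ⬝ᵥ (x i - sampleMean x)) ^ 2 = n * t ⬝ᵥ sampleVar x *ᵥ t := by
    rw [← smul_eq_mul, ← dotProduct_smul, ← smul_mulVec, ← sum_vecMulVec_sub_sampleMean,
      sum_mulVec, dotProduct_sum]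
    refine Finset.sum_congr rfl fun i _ => ?_
    rw [vecMulVec_mulVec, dotProduct_smul, dotProduct_comm _ t, sq]
    simp
  have hsplit : ∀ i, (t ⬝ᵥ x i) ^ 2 = (t ⬝ᵥ (x i - sampleMean x)) ^ 2
      + 2 * t ⬝ᵥ sampleMean x * t ⬝ᵥ x i - (t ⬝ᵥ sampleMean x) ^ 2 := fun i => by
    rw [dotProduct_sub]; ring
  simp only [hsplit, Finset.sum_sub_distrib, Finset.sum_add_distrib, hcentred, ← Finset.mul_sum,
    sum_dotProduct, Finset.sum_const, Finset.card_univ, Fintype.card_fin, nsmul_eq_mul]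
  ring

lemma sum_dotProduct_self :
    ∑ i, x i ⬝ᵥ x i = n * ((sampleVar x).trace + sampleMean x ⬝ᵥ sampleMean x) := by
  have hcentred : ∑ i, (x i - sampleMean x) ⬝ᵥ (x i - sampleMean x) = n * (sampleVar x).trace := by
    rw [← smul_eq_mul, ← trace_smul, ← sum_vecMulVec_sub_sampleMean, trace_sum]
    simp only [trace_vecMulVec]
  have hsplit : ∀ i, x i ⬝ᵥ x i = (x i - sampleMean x) ⬝ᵥ (x i - sampleMean x)
      + 2 * sampleMean x ⬝ᵥ x i - sampleMean x ⬝ᵥ sampleMean x := fun i => by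
    simp only [dotProduct_sub, sub_dotProduct, dotProduct_comm (x i) (sampleMean x)]; ring
  rw [Finset.sum_congr rfl fun i _ => hsplit i, Finset.sum_sub_distrib, Finset.sum_add_distrib,
    hcentred, ← Finset.mul_sum, sum_dotProduct, Finset.sum_const, Finset.card_univ,
    Fintype.card_fin, nsmul_eq_mul]
  ring

lemma sum_sum_dotProduct : ∑ i, ∑ j, x i ⬝ᵥ x j = n ^ 2 * sampleMean x ⬝ᵥ sampleMean x := by
  simp_rw [sum_dotProduct, dotProduct_comm _ (sampleMean x), ← Finset.mul_sum, sum_dotProduct]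
  ring

lemma zero_le_dotProduct_self (u : Fin m → ℝ) : 0 ≤ u ⬝ᵥ u := by
  simpa using dotProduct_star_self_nonneg u

lemma dotProduct_sq_le (u v : Fin m → ℝ) : (u ⬝ᵥ v) ^ 2 ≤ u ⬝ᵥ u * v ⬝ᵥ v := by
  simpa [dotProduct, sq] using Finset.sum_mul_sq_le_sq_mul_sq Finset.univ u v

lemma abs_dotProduct_rpow_le (hp : 0 ≤ p) (u v : Fin m → ℝ) :
    |u ⬝ᵥ v| ^ p ≤ (u ⬝ᵥ u) ^ (p / 2) * (v ⬝ᵥ v) ^ (p / 2) := by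
  rw [← Real.mul_rpow (zero_le_dotProduct_self u) (zero_le_dotProduct_self v)]
  calc |u ⬝ᵥ v| ^ p = ((u ⬝ᵥ v) ^ 2) ^ (p / 2) := by
        rw [← sq_abs, ← Real.rpow_natCast, ← Real.rpow_mul (abs_nonneg _)]
        congr 1; push_cast; ring
    _ ≤ _ := Real.rpow_le_rpow (sq_nonneg _) (dotProduct_sq_le u v) (by positivity)

end SampleMoments

section Standardized

open Matrix

variable {n m : ℕ} {z : Fin n → Fin m → ℝ} {p C : ℝ}

/-- Standardized data: the sample variance of `z` is the identity, the sample mean is of order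
`n^{-1/2}`, and the `p`-th sample moment of the Euclidean lengths is at most `C`. -/
structure IsStandardized (z : Fin n → Fin m → ℝ) (p C : ℝ) : Prop where
  sampleVar_eq_one : sampleVar z = 1
  mul_sampleMean_le : n * sampleMean z ⬝ᵥ sampleMean z ≤ C
  sum_rpow_le : ∑ i, (z i ⬝ᵥ z i) ^ (p / 2) ≤ n * C

namespace IsStandardized

lemma const_nonneg (h : IsStandardized z p C) : 0 ≤ C :=
  (mul_nonneg n.cast_nonneg (zero_le_dotProduct_self _)).trans h.mul_sampleMean_le

lemma mul_dotProduct_sampleMean_sq_le (h : IsStandardized z p C) (t : Fin m → ℝ) :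
    n * (t ⬝ᵥ sampleMean z) ^ 2 ≤ t ⬝ᵥ t * C :=
  calc n * (t ⬝ᵥ sampleMean z) ^ 2 ≤ n * (t ⬝ᵥ t * sampleMean z ⬝ᵥ sampleMean z) := by
        gcongr; exact dotProduct_sq_le t _
    _ = t ⬝ᵥ t * (n * sampleMean z ⬝ᵥ sampleMean z) := by ring
    _ ≤ t ⬝ᵥ t * C := mul_le_mul_of_nonneg_left h.mul_sampleMean_le (zero_le_dotProduct_self t)

lemma sum_dotProduct_sq (h : IsStandardized z p C) (t : Fin m → ℝ) :
    ∑ i, (t ⬝ᵥ z i) ^ 2 = n * (t ⬝ᵥ t + (t ⬝ᵥ sampleMean z) ^ 2) := by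
  rw [Resampling.sum_dotProduct_sq, h.sampleVar_eq_one, one_mulVec]

lemma sum_abs_dotProduct_rpow_le (h : IsStandardized z p C) (hp : 0 ≤ p) (t : Fin m → ℝ) :
    ∑ i, |t ⬝ᵥ z i| ^ p ≤ n * ((t ⬝ᵥ t) ^ (p / 2) * C) :=
  calc ∑ i, |t ⬝ᵥ z i| ^ p ≤ ∑ i, (t ⬝ᵥ t) ^ (p / 2) * (z i ⬝ᵥ z i) ^ (p / 2) :=
        Finset.sum_le_sum fun i _ => abs_dotProduct_rpow_le hp t (z i)
    _ ≤ (t ⬝ᵥ t) ^ (p / 2) * (n * C) := by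
        rw [← Finset.mul_sum]
        exact mul_le_mul_of_nonneg_left h.sum_rpow_le
          (Real.rpow_nonneg (zero_le_dotProduct_self t) _)
    _ = n * ((t ⬝ᵥ t) ^ (p / 2) * C) := by ring

lemma sum_dotProduct_self (h : IsStandardized z p C) :
    ∑ i, z i ⬝ᵥ z i = n * (m + sampleMean z ⬝ᵥ sampleMean z) := by
  rw [Resampling.sum_dotProduct_self, h.sampleVar_eq_one]
  simp

lemma sum_sum_dotProduct_sq (h : IsStandardized z p C) :
    ∑ i, ∑ j, (z i ⬝ᵥ z j) ^ 2 = n ^ 2 * (m + 2 * sampleMean z ⬝ᵥ sampleMean z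
      + (sampleMean z ⬝ᵥ sampleMean z) ^ 2) := by
  simp_rw [h.sum_dotProduct_sq, dotProduct_comm _ (sampleMean z)]
  rw [← Finset.mul_sum, Finset.sum_add_distrib, h.sum_dotProduct_self, h.sum_dotProduct_sq]
  ring

lemma sum_sum_abs_dotProduct_rpow_le (h : IsStandardized z p C) (hp : 0 ≤ p) :
    ∑ i, ∑ j, |z i ⬝ᵥ z j| ^ p ≤ (n * C) ^ 2 :=
  calc ∑ i, ∑ j, |z i ⬝ᵥ z j| ^ p ≤ ∑ i, ∑ j, (z i ⬝ᵥ z i) ^ (p / 2) * (z j ⬝ᵥ z j) ^ (p / 2) :=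
        Finset.sum_le_sum fun i _ => Finset.sum_le_sum fun j _ =>
          abs_dotProduct_rpow_le hp (z i) (z j)
    _ = (∑ i, (z i ⬝ᵥ z i) ^ (p / 2)) ^ 2 := by rw [sq, Finset.sum_mul_sum]
    _ ≤ (n * C) ^ 2 := pow_le_pow_left₀ (Finset.sum_nonneg fun i _ =>
        Real.rpow_nonneg (zero_le_dotProduct_self _) _) h.sum_rpow_le 2

lemma dotProduct_self_le (h : IsStandardized z p C) (hp : 0 < p) (i : Fin n) :
    z i ⬝ᵥ z i ≤ (n * C) ^ (2 / p) := by
  have hnonneg := fun j => zero_le_dotProduct_self (z j)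
  have hle : (z i ⬝ᵥ z i) ^ (p / 2) ≤ n * C :=
    (Finset.single_le_sum (fun j _ => Real.rpow_nonneg (hnonneg j) _) (Finset.mem_univ i)).trans
      h.sum_rpow_le
  rw [← inv_div]
  exact (Real.le_rpow_inv_iff_of_pos (hnonneg i)
    (mul_nonneg n.cast_nonneg h.const_nonneg) (by positivity)).2 hle

lemma sum_dotProduct_self_sq_le (h : IsStandardized z p C) (hp : 0 < p) :
    ∑ i, (z i ⬝ᵥ z i) ^ 2 ≤ (n * C) ^ (2 / p) * (n * m + C) :=
  calc ∑ i, (z i ⬝ᵥ z i) ^ 2 ≤ ∑ i, (n * C) ^ (2 / p) * z i ⬝ᵥ z i :=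
        Finset.sum_le_sum fun i _ => by
          rw [sq]
          exact mul_le_mul_of_nonneg_right (h.dotProduct_self_le hp i) (zero_le_dotProduct_self _)
    _ = (n * C) ^ (2 / p) * (n * m + n * sampleMean z ⬝ᵥ sampleMean z) := by
        rw [← Finset.mul_sum, h.sum_dotProduct_self]; ring
    _ ≤ _ := by
        have := mul_nonneg n.cast_nonneg h.const_nonneg
        gcongr
        exact h.mul_sampleMean_le

end IsStandardized

end Standardized

section PairAverages

open Matrix Finset

lemma inv_natCast_mul_pred_le {n : ℕ} (hn : 1 < n) : ((n : ℝ) * (n - 1))⁻¹ ≤ 2 / n ^ 2 := by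
  have hn' : (2 : ℝ) ≤ n := by exact_mod_cast hn
  rw [← inv_div]
  exact inv_anti₀ (by positivity) (by nlinarith)

variable {n m : ℕ} {z : Fin n → Fin m → ℝ} {p C : ℝ}

namespace IsStandardized

lemma sampleMean_dotProduct_self_le (h : IsStandardized z p C) (hn : 0 < n) :
    sampleMean z ⬝ᵥ sampleMean z ≤ C := by
  have hn' : (1 : ℝ) ≤ n := by exact_mod_cast hn
  exact (le_mul_of_one_le_left (zero_le_dotProduct_self _) hn').trans h.mul_sampleMean_le

lemma abs_average_offDiag_dotProduct_le (h : IsStandardized z p C) (hn : 1 < n) :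
    |((n : ℝ) * (n - 1))⁻¹ * ∑ i ∈ univ.offDiag, z i.1 ⬝ᵥ z i.2| ≤ 2 * (C + m) / n := by
  have hn' : (2 : ℝ) ≤ n := by exact_mod_cast hn
  have hD := h.sampleMean_dotProduct_self_le (by omega)
  have hD0 := zero_le_dotProduct_self (sampleMean z)
  have hsum : |∑ i ∈ univ.offDiag, z i.1 ⬝ᵥ z i.2| ≤ n * (C + m) := by
    rw [sum_offDiag_eq_sub fun i j => z i ⬝ᵥ z j, sum_sum_dotProduct, h.sum_dotProduct_self,
      abs_le]
    have := h.mul_sampleMean_le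
    constructor <;> nlinarith [mul_nonneg n.cast_nonneg (m.cast_nonneg (α := ℝ))]
  rw [abs_mul, abs_of_nonneg (inv_nonneg.2 (by nlinarith))]
  calc _ ≤ 2 / (n : ℝ) ^ 2 * (n * (C + m)) := by
        gcongr
        exact inv_natCast_mul_pred_le hn
    _ = 2 * (C + m) / n := by field_simp

lemma abs_sum_offDiag_dotProduct_sq_sub_le (h : IsStandardized z p C) (hp : 0 < p) (hn : 0 < n) :
    |∑ i ∈ univ.offDiag, (z i.1 ⬝ᵥ z i.2) ^ 2 - n * (n - 1) * m|
      ≤ n * (m + 2 * C + C ^ 2 + (n * C) ^ (2 / p) * (m + C)) := by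
  have hn' : (1 : ℝ) ≤ n := by exact_mod_cast hn
  have hC := h.const_nonneg
  have hD := h.mul_sampleMean_le
  have hD0 := zero_le_dotProduct_self (sampleMean z)
  have hdiag := h.sum_dotProduct_self_sq_le hp
  have hdiag0 : 0 ≤ ∑ i, (z i ⬝ᵥ z i) ^ 2 := sum_nonneg fun i _ => sq_nonneg _
  rw [sum_offDiag_eq_sub fun i j => (z i ⬝ᵥ z j) ^ 2, h.sum_sum_dotProduct_sq]
  set D := sampleMean z ⬝ᵥ sampleMean z
  have hD2 : (n * D) ^ 2 ≤ C ^ 2 := by gcongr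
  have hnC : C ≤ n * C := le_mul_of_one_le_left hC hn'
  have hlarge : (n * C) ^ (2 / p) * (n * m + C) ≤ n * ((n * C) ^ (2 / p) * (m + C)) := by
    calc _ ≤ (n * C) ^ (2 / p) * (n * m + n * C) := by gcongr
      _ = _ := by ring
  have hmain : n ^ 2 * (m + 2 * D + D ^ 2) - ∑ i, (z i ⬝ᵥ z i) ^ 2 - n * (n - 1) * m
      = n * m + 2 * n * (n * D) + (n * D) ^ 2 - ∑ i, (z i ⬝ᵥ z i) ^ 2 := by ring
  have hnD : n * (n * D) ≤ n * C := by gcongr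
  rw [hmain, abs_le]
  constructor <;> nlinarith

lemma abs_average_offDiag_dotProduct_sq_sub_le (h : IsStandardized z p C) (hp : 0 < p)
    (hn : 1 < n) :
    |((n : ℝ) * (n - 1))⁻¹ * ∑ i ∈ univ.offDiag, (z i.1 ⬝ᵥ z i.2) ^ 2 - m|
      ≤ 2 * (m + 2 * C + C ^ 2) * (n : ℝ)⁻¹
        + 2 * C ^ (2 / p) * (m + C) * (n : ℝ) ^ (-(1 - 2 / p)) := by
  have hn' : (2 : ℝ) ≤ n := by exact_mod_cast hn
  have hN : (0 : ℝ) < n * (n - 1) := by nlinarith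
  have hcentre : ∀ s : ℝ, (n * (n - 1) : ℝ)⁻¹ * s - m
      = (n * (n - 1) : ℝ)⁻¹ * (s - n * (n - 1) * m) := fun s => by
    rw [mul_sub (_⁻¹), inv_mul_cancel_left₀ hN.ne']
  rw [hcentre, abs_mul, abs_of_pos (inv_pos.2 hN)]
  calc _ ≤ 2 / (n : ℝ) ^ 2 * (n * (m + 2 * C + C ^ 2 + (n * C) ^ (2 / p) * (m + C))) := by
        gcongr
        · exact inv_natCast_mul_pred_le hn
        · exact h.abs_sum_offDiag_dotProduct_sq_sub_le hp (by omega)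
    _ = _ := by
        rw [neg_sub, Real.rpow_sub (by positivity), Real.rpow_one,
          Real.mul_rpow n.cast_nonneg h.const_nonneg]
        field_simp

lemma average_offDiag_abs_dotProduct_rpow_le (h : IsStandardized z p C) (hp : 0 ≤ p)
    (hn : 1 < n) :
    ((n : ℝ) * (n - 1))⁻¹ * ∑ i ∈ univ.offDiag, |z i.1 ⬝ᵥ z i.2| ^ p ≤ 2 * C ^ 2 :=
  calc _ ≤ 2 / (n : ℝ) ^ 2 * (n * C) ^ 2 := by
        gcongr
        · exact inv_natCast_mul_pred_le hn
        · exact (sum_offDiag_le (g := fun i j => |z i ⬝ᵥ z j| ^ p)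
            fun i => Real.rpow_nonneg (abs_nonneg _) p).trans (h.sum_sum_abs_dotProduct_rpow_le hp)
    _ = 2 * C ^ 2 := by field_simp

end IsStandardized

end PairAverages

section StandardizedLimits

open Matrix Finset

variable {m : ℕ} {n R : ℕ → ℕ} {z : ∀ k, Fin (n k) → Fin m → ℝ} {p C : ℝ}

lemma tendsto_sqrt_mul_average_dotProduct (hn : Tendsto n atTop atTop)
    (hRn : Tendsto (fun k => (R k : ℝ) / n k) atTop (𝓝 0))
    (hz : ∀ᶠ k in atTop, IsStandardized (z k) p C) (t : Fin m → ℝ) :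
    Tendsto (fun k => √(R k : ℝ) * ((n k : ℝ)⁻¹ * ∑ i, t ⬝ᵥ z k i)) atTop (𝓝 0) := by
  have hlim : Tendsto (fun k => √((R k : ℝ) / n k * (t ⬝ᵥ t * C))) atTop (𝓝 0) := by
    simpa using (hRn.mul_const (t ⬝ᵥ t * C)).sqrt
  refine squeeze_zero_norm' ?_ hlim
  filter_upwards [hz, hn.eventually_gt_atTop 0] with k hk hk0
  have hk0' : (0 : ℝ) < n k := by exact_mod_cast hk0
  rw [sum_dotProduct, inv_mul_cancel_left₀ hk0'.ne']
  refine Real.le_sqrt_of_sq_le ?_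
  rw [Real.norm_eq_abs, sq_abs, mul_pow, Real.sq_sqrt (R k).cast_nonneg]
  calc (R k : ℝ) * (t ⬝ᵥ sampleMean (z k)) ^ 2
      = R k / n k * (n k * (t ⬝ᵥ sampleMean (z k)) ^ 2) := by field_simp
    _ ≤ _ := mul_le_mul_of_nonneg_left (hk.mul_dotProduct_sampleMean_sq_le t) (by positivity)

lemma tendsto_average_dotProduct_sq (hn : Tendsto n atTop atTop)
    (hz : ∀ᶠ k in atTop, IsStandardized (z k) p C) (t : Fin m → ℝ) :
    Tendsto (fun k => (n k : ℝ)⁻¹ * ∑ i, (t ⬝ᵥ z k i) ^ 2) atTop (𝓝 (t ⬝ᵥ t)) := by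
  have hlim : Tendsto (fun k => t ⬝ᵥ t * C / (n k : ℝ)) atTop (𝓝 0) :=
    (tendsto_natCast_atTop_atTop.comp hn).const_div_atTop _
  rw [tendsto_iff_norm_sub_tendsto_zero]
  refine squeeze_zero' (.of_forall fun _ => norm_nonneg _) ?_ hlim
  filter_upwards [hz, hn.eventually_gt_atTop 0] with k hk hk0
  have hk0' : (0 : ℝ) < n k := by exact_mod_cast hk0
  rw [hk.sum_dotProduct_sq, inv_mul_cancel_left₀ hk0'.ne', add_sub_cancel_left, Real.norm_eq_abs,
    abs_of_nonneg (sq_nonneg _), le_div_iff₀' hk0']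
  exact hk.mul_dotProduct_sampleMean_sq_le t

lemma eventually_average_abs_dotProduct_rpow_le (hn : Tendsto n atTop atTop)
    (hz : ∀ᶠ k in atTop, IsStandardized (z k) p C) (hp : 0 ≤ p) (t : Fin m → ℝ) :
    ∀ᶠ k in atTop, (n k : ℝ)⁻¹ * ∑ i, |t ⬝ᵥ z k i| ^ p ≤ (t ⬝ᵥ t) ^ (p / 2) * C := by
  filter_upwards [hz, hn.eventually_gt_atTop 0] with k hk hk0
  rw [inv_mul_le_iff₀ (by exact_mod_cast hk0)]
  exact hk.sum_abs_dotProduct_rpow_le hp t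

lemma tendsto_sqrt_mul_average_offDiag_dotProduct (hn : Tendsto n atTop atTop)
    (hRn : Tendsto (fun k => √(R k : ℝ) / n k) atTop (𝓝 0))
    (hz : ∀ᶠ k in atTop, IsStandardized (z k) p C) :
    Tendsto (fun k => √(R k : ℝ) * (((n k : ℝ) * (n k - 1))⁻¹ *
      ∑ i ∈ univ.offDiag, z k i.1 ⬝ᵥ z k i.2)) atTop (𝓝 0) := by
  have hlim : Tendsto (fun k => √(R k : ℝ) / n k * (2 * (C + m))) atTop (𝓝 0) := by
    simpa using hRn.mul_const (2 * (C + m))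
  refine squeeze_zero_norm' ?_ hlim
  filter_upwards [hz, hn.eventually_gt_atTop 1] with k hk hk1
  rw [norm_mul, Real.norm_of_nonneg (Real.sqrt_nonneg _), div_mul_eq_mul_div, mul_div_assoc]
  gcongr
  exact hk.abs_average_offDiag_dotProduct_le hk1

lemma tendsto_average_offDiag_dotProduct_sq (hn : Tendsto n atTop atTop) (hp : 2 < p)
    (hz : ∀ᶠ k in atTop, IsStandardized (z k) p C) :
    Tendsto (fun k => ((n k : ℝ) * (n k - 1))⁻¹ * ∑ i ∈ univ.offDiag, (z k i.1 ⬝ᵥ z k i.2) ^ 2)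
      atTop (𝓝 m) := by
  have hn' : Tendsto (fun k => (n k : ℝ)) atTop atTop := tendsto_natCast_atTop_atTop.comp hn
  have hexp : 0 < 1 - 2 / p := sub_pos.2 ((div_lt_one (by linarith)).2 hp)
  have hlim : Tendsto (fun k => 2 * (m + 2 * C + C ^ 2) * (n k : ℝ)⁻¹
      + 2 * C ^ (2 / p) * (m + C) * (n k : ℝ) ^ (-(1 - 2 / p))) atTop (𝓝 0) := by
    simpa using ((tendsto_inv_atTop_zero.comp hn').const_mul (2 * (m + 2 * C + C ^ 2))).add
      (((tendsto_rpow_neg_atTop hexp).comp hn').const_mul (2 * C ^ (2 / p) * (m + C)))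
  rw [tendsto_iff_norm_sub_tendsto_zero]
  refine squeeze_zero' (.of_forall fun _ => norm_nonneg _) ?_ hlim
  filter_upwards [hz, hn.eventually_gt_atTop 1] with k hk hk1
  exact hk.abs_average_offDiag_dotProduct_sq_sub_le (by linarith) hk1

lemma eventually_average_offDiag_abs_dotProduct_rpow_le (hn : Tendsto n atTop atTop)
    (hz : ∀ᶠ k in atTop, IsStandardized (z k) p C) (hp : 0 ≤ p) :
    ∀ᶠ k in atTop, ((n k : ℝ) * (n k - 1))⁻¹ * ∑ i ∈ univ.offDiag, |z k i.1 ⬝ᵥ z k i.2| ^ p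
      ≤ 2 * C ^ 2 := by
  filter_upwards [hz, hn.eventually_gt_atTop 1] with k hk hk1
  exact hk.average_offDiag_abs_dotProduct_rpow_le hp hk1

end StandardizedLimits

section Standardization

open Matrix

variable {n m : ℕ}

section InvSqrt

open scoped MatrixOrder

variable {A : Matrix (Fin m) (Fin m) ℝ}

lemma invSqrt_mul_self (hA : A.PosSemidef) : invSqrt A * invSqrt A = A⁻¹ := by
  rw [invSqrt, ← Matrix.mul_inv_rev, CFC.sqrt_mul_sqrt_self A hA.nonneg]

lemma transpose_invSqrt (A : Matrix (Fin m) (Fin m) ℝ) : (invSqrt A)ᵀ = invSqrt A := by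
  have h := (CFC.sqrt_nonneg A).posSemidef.inv.1
  rwa [IsHermitian, conjTranspose_eq_transpose_of_trivial] at h

lemma invSqrt_mul_mul_invSqrt (hA : A.PosSemidef) (hu : IsUnit A) :
    invSqrt A * A * invSqrt A = 1 := by
  have hs : IsUnit (CFC.sqrt A).det := by
    rwa [← isUnit_iff_isUnit_det, CFC.isUnit_sqrt_iff A hA.nonneg]
  calc invSqrt A * A * invSqrt A
      = (CFC.sqrt A)⁻¹ * (CFC.sqrt A * CFC.sqrt A) * (CFC.sqrt A)⁻¹ := by
        rw [CFC.sqrt_mul_sqrt_self A hA.nonneg, invSqrt]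
    _ = 1 := by rw [nonsing_inv_mul_cancel_left _ _ hs, mul_nonsing_inv _ hs]

lemma dotProduct_invSqrt_mulVec (hA : A.PosSemidef) (u v : Fin m → ℝ) :
    (invSqrt A *ᵥ u) ⬝ᵥ (invSqrt A *ᵥ v) = u ⬝ᵥ A⁻¹ *ᵥ v := by
  rw [← invSqrt_mul_self hA, ← mulVec_mulVec, dotProduct_mulVec u, ← mulVec_transpose,
    transpose_invSqrt]

end InvSqrt

lemma abs_dotProduct_mulVec_le (A : Matrix (Fin m) (Fin m) ℝ) (v : Fin m → ℝ) :
    |v ⬝ᵥ A *ᵥ v| ≤ (∑ j, ∑ l, |A j l|) * ‖v‖ ^ 2 := by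
  have hexpand : v ⬝ᵥ A *ᵥ v = ∑ j, ∑ l, A j l * (v j * v l) := by
    simp only [dotProduct, mulVec, Finset.mul_sum]
    exact Finset.sum_congr rfl fun j _ => Finset.sum_congr rfl fun l _ => by ring
  simp only [hexpand, Finset.sum_mul]
  refine (Finset.abs_sum_le_sum_abs _ _).trans (Finset.sum_le_sum fun j _ => ?_)
  refine (Finset.abs_sum_le_sum_abs _ _).trans (Finset.sum_le_sum fun l _ => ?_)
  rw [abs_mul, abs_mul, sq]
  gcongr
  · exact norm_le_pi_norm v j
  · exact norm_le_pi_norm v l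

variable (x : Fin n → Fin m → ℝ) (μ : Fin m → ℝ)

lemma sampleMean_mulVec_sub (hn : 0 < n) (A : Matrix (Fin m) (Fin m) ℝ) :
    sampleMean (fun i => A *ᵥ (x i - μ)) = A *ᵥ (sampleMean x - μ) := by
  have hn' : (n : ℝ) ≠ 0 := by exact_mod_cast hn.ne'
  rw [sampleMean, ← mulVec_sum, sum_sub_eq_natCast_smul, mulVec_smul, inv_smul_smul₀ hn']

lemma sampleVar_mulVec_sub (A : Matrix (Fin m) (Fin m) ℝ) :
    sampleVar (fun i => A *ᵥ (x i - μ)) = A * sampleVar x * Aᵀ := by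
  rcases n.eq_zero_or_pos with rfl | hn
  · simp [sampleVar]
  · have hcentred : ∀ i, A *ᵥ (x i - μ) - A *ᵥ (sampleMean x - μ) = A *ᵥ (x i - sampleMean x) :=
      fun i => by rw [← mulVec_sub, sub_sub_sub_cancel_right]
    simp_rw [sampleVar, sampleMean_mulVec_sub x μ hn, hcentred, mul_smul_comm, smul_mul_assoc,
      Finset.mul_sum, Finset.sum_mul, mul_vecMulVec, vecMulVec_mul, vecMul_transpose]

/-- The data `Σ̂^{-1/2} (xᵢ - μ)`, centred at `μ` and scaled by the sample variance. -/
def standardize : Fin n → Fin m → ℝ :=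
  fun i => invSqrt (sampleVar x) *ᵥ (x i - μ)

lemma sampleMean_standardize (hn : 0 < n) :
    sampleMean (standardize x μ) = invSqrt (sampleVar x) *ᵥ (sampleMean x - μ) :=
  sampleMean_mulVec_sub x μ hn _

lemma sampleVar_standardize (hx : IsUnit (sampleVar x)) : sampleVar (standardize x μ) = 1 := by
  unfold standardize
  rw [sampleVar_mulVec_sub, transpose_invSqrt,
    invSqrt_mul_mul_invSqrt (posSemidef_sampleVar x) hx]

variable {x μ} {K M p : ℝ}

lemma dotProduct_self_invSqrt_mulVec_le (hK : ∑ j, ∑ l, |(sampleVar x)⁻¹ j l| ≤ K)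
    (v : Fin m → ℝ) :
    (invSqrt (sampleVar x) *ᵥ v) ⬝ᵥ (invSqrt (sampleVar x) *ᵥ v) ≤ K * ‖v‖ ^ 2 := by
  rw [dotProduct_invSqrt_mulVec (posSemidef_sampleVar x)]
  exact (le_abs_self _).trans ((abs_dotProduct_mulVec_le _ v).trans (by gcongr))

lemma sqrt_mul_norm_sampleMean_sub :
    √(n : ℝ) * ‖sampleMean x - μ‖ = ‖(√(n : ℝ))⁻¹ • ∑ i, (x i - μ)‖ := by
  rw [sum_sub_eq_natCast_smul, smul_smul, ← div_eq_inv_mul, Real.div_sqrt, norm_smul,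
    Real.norm_of_nonneg (Real.sqrt_nonneg _)]

lemma norm_sampleMean_le (hn : 0 < n) (hp : 1 ≤ p)
    (hmom : (n : ℝ)⁻¹ * ∑ i, ‖x i‖ ^ p ≤ M) : ‖sampleMean x‖ ≤ 1 + M := by
  have hn' : (0 : ℝ) < n := by exact_mod_cast hn
  have hle : ∀ i, ‖x i‖ ≤ 1 + ‖x i‖ ^ p := fun i => by
    rcases le_total ‖x i‖ 1 with h | h
    · exact h.trans (le_add_of_nonneg_right (by positivity))
    · exact (Real.self_le_rpow_of_one_le h hp).trans (le_add_of_nonneg_left zero_le_one)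
  rw [inv_mul_le_iff₀ hn'] at hmom
  rw [sampleMean, norm_smul, Real.norm_of_nonneg (inv_nonneg.2 hn'.le), inv_mul_le_iff₀ hn']
  calc ‖∑ i, x i‖ ≤ ∑ i, (1 + ‖x i‖ ^ p) :=
        (norm_sum_le _ _).trans (Finset.sum_le_sum fun i _ => hle i)
    _ = n + ∑ i, ‖x i‖ ^ p := by simp [Finset.sum_add_distrib]
    _ ≤ n * (1 + M) := by linarith

lemma norm_centre_le (hn : 0 < n) (hp : 1 ≤ p)
    (hmean : ‖(√(n : ℝ))⁻¹ • ∑ i, (x i - μ)‖ ≤ M) (hmom : (n : ℝ)⁻¹ * ∑ i, ‖x i‖ ^ p ≤ M) :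
    ‖μ‖ ≤ 1 + 2 * M := by
  have hsqrt : 1 ≤ √(n : ℝ) := Real.one_le_sqrt.2 (by exact_mod_cast hn)
  have hsub : ‖sampleMean x - μ‖ ≤ M :=
    (le_mul_of_one_le_left (norm_nonneg _) hsqrt).trans
      (sqrt_mul_norm_sampleMean_sub.trans_le hmean)
  calc ‖μ‖ = ‖sampleMean x - (sampleMean x - μ)‖ := by rw [sub_sub_cancel]
    _ ≤ (1 + M) + M := (norm_sub_le _ _).trans (add_le_add (norm_sampleMean_le hn hp hmom) hsub)
    _ = 1 + 2 * M := by ring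

lemma sum_norm_sub_rpow_le (hn : 0 < n) (hp : 1 ≤ p)
    (hmean : ‖(√(n : ℝ))⁻¹ • ∑ i, (x i - μ)‖ ≤ M) (hmom : (n : ℝ)⁻¹ * ∑ i, ‖x i‖ ^ p ≤ M) :
    ∑ i, ‖x i - μ‖ ^ p ≤ n * (2 ^ (p - 1) * (M + (1 + 2 * M) ^ p)) := by
  have hμ := norm_centre_le hn hp hmean hmom
  rw [inv_mul_le_iff₀ (by exact_mod_cast hn)] at hmom
  have hterm : ∀ i, ‖x i - μ‖ ^ p ≤ 2 ^ (p - 1) * (‖x i‖ ^ p + (1 + 2 * M) ^ p) := fun i =>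
    calc ‖x i - μ‖ ^ p ≤ (‖x i‖ + ‖μ‖) ^ p :=
          Real.rpow_le_rpow (norm_nonneg _) (norm_sub_le _ _) (by linarith)
      _ ≤ 2 ^ (p - 1) * (‖x i‖ ^ p + ‖μ‖ ^ p) := by
          exact_mod_cast NNReal.rpow_add_le_mul_rpow_add_rpow ‖x i‖₊ ‖μ‖₊ hp
      _ ≤ _ := by gcongr
  calc ∑ i, ‖x i - μ‖ ^ p ≤ 2 ^ (p - 1) * (∑ i, ‖x i‖ ^ p + n * (1 + 2 * M) ^ p) := by
        refine (Finset.sum_le_sum fun i _ => hterm i).trans_eq ?_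
        simp [← Finset.mul_sum, Finset.sum_add_distrib]
    _ ≤ 2 ^ (p - 1) * (n * M + n * (1 + 2 * M) ^ p) := by gcongr
    _ = _ := by ring

lemma isStandardized_standardize (hn : 0 < n) (hp : 1 ≤ p) (hx : IsUnit (sampleVar x))
    (hK : ∑ j, ∑ l, |(sampleVar x)⁻¹ j l| ≤ K)
    (hmean : ‖(√(n : ℝ))⁻¹ • ∑ i, (x i - μ)‖ ≤ M) (hmom : (n : ℝ)⁻¹ * ∑ i, ‖x i‖ ^ p ≤ M) :
    IsStandardized (standardize x μ) p
      (max (K * M ^ 2) (K ^ (p / 2) * (2 ^ (p - 1) * (M + (1 + 2 * M) ^ p)))) := by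
  have hK0 : 0 ≤ K := le_trans (by positivity) hK
  refine ⟨sampleVar_standardize x μ hx, le_max_of_le_left ?_, ?_⟩
  · rw [sampleMean_standardize x μ hn]
    calc (n : ℝ) * _ ≤ n * (K * ‖sampleMean x - μ‖ ^ 2) :=
          mul_le_mul_of_nonneg_left (dotProduct_self_invSqrt_mulVec_le hK _) n.cast_nonneg
      _ = K * (√(n : ℝ) * ‖sampleMean x - μ‖) ^ 2 := by
          rw [mul_pow, Real.sq_sqrt n.cast_nonneg]; ring
      _ ≤ K * M ^ 2 := by rw [sqrt_mul_norm_sampleMean_sub]; gcongr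
  · have hterm : ∀ i, (standardize x μ i ⬝ᵥ standardize x μ i) ^ (p / 2)
        ≤ K ^ (p / 2) * ‖x i - μ‖ ^ p := fun i =>
      calc _ ≤ (K * ‖x i - μ‖ ^ 2) ^ (p / 2) := Real.rpow_le_rpow (zero_le_dotProduct_self _)
            (dotProduct_self_invSqrt_mulVec_le hK _) (by linarith)
        _ = K ^ (p / 2) * ‖x i - μ‖ ^ p := by
            rw [Real.mul_rpow hK0 (by positivity), ← Real.rpow_natCast, ← Real.rpow_mul
              (norm_nonneg _), Nat.cast_two, mul_div_cancel₀ _ two_ne_zero]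
    calc _ ≤ K ^ (p / 2) * ∑ i, ‖x i - μ‖ ^ p := by
          rw [Finset.mul_sum]; exact Finset.sum_le_sum fun i _ => hterm i
      _ ≤ K ^ (p / 2) * (n * (2 ^ (p - 1) * (M + (1 + 2 * M) ^ p))) := by
          gcongr; exact sum_norm_sub_rpow_le hn hp hmean hmom
      _ = n * (K ^ (p / 2) * (2 ^ (p - 1) * (M + (1 + 2 * M) ^ p))) := by ring
      _ ≤ _ := by gcongr; exact le_max_right _ _

end Standardization

section RegularData

open Matrix

/-- The law of `R` independent uniform random permutations of `Fin n`. -/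
def permLaw (n R : ℕ) : Measure (Fin R → Equiv.Perm (Fin n)) :=
  Measure.pi fun _ => uniformOn Set.univ

instance isProbabilityMeasure_permLaw (n R : ℕ) : IsProbabilityMeasure (permLaw n R) := by
  unfold permLaw; infer_instance

variable {m : ℕ} {n R : ℕ → ℕ} {x : ∀ k, Fin (n k) → Fin m → ℝ} {μ : ℕ → Fin m → ℝ}
  {S : Matrix (Fin m) (Fin m) ℝ} {p M : ℝ}

/-- Nonrandom data sets `x k` with centres `μ k` along which the hypotheses on the triangular array
hold: the centring error is `O(n^{-1/2})`, the `p`-th sample moments are bounded, and the sample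
variances converge to `S`. -/
structure IsRegular (x : ∀ k, Fin (n k) → Fin m → ℝ) (μ : ℕ → Fin m → ℝ)
    (S : Matrix (Fin m) (Fin m) ℝ) (p M : ℝ) : Prop where
  tendsto_size : Tendsto n atTop atTop
  norm_sum_sub_le : ∀ k, ‖(√(n k : ℝ))⁻¹ • ∑ i, (x k i - μ k)‖ ≤ M
  average_norm_rpow_le : ∀ k, (n k : ℝ)⁻¹ * ∑ i, ‖x k i‖ ^ p ≤ M
  tendsto_sampleVar : Tendsto (fun k => sampleVar (x k)) atTop (𝓝 S)

namespace IsRegular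

lemma exists_eventually_isStandardized (h : IsRegular x μ S p M) (hS : IsUnit S) (hp : 1 ≤ p) :
    ∃ C, ∀ᶠ k in atTop, IsStandardized (standardize (x k) (μ k)) p C := by
  have hdet : S.det ≠ 0 := ((isUnit_iff_isUnit_det S).1 hS).ne_zero
  have hinv : Tendsto (fun k => (sampleVar (x k))⁻¹) atTop (𝓝 S⁻¹) :=
    (continuousAt_matrix_inv S (by
      simpa only [Ring.inverse_eq_inv'] using continuousAt_inv₀ hdet)).tendsto.comp
      h.tendsto_sampleVar
  have hentries : Tendsto (fun k => ∑ j, ∑ l, |(sampleVar (x k))⁻¹ j l|) atTop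
      (𝓝 (∑ j, ∑ l, |S⁻¹ j l|)) :=
    ((by fun_prop : Continuous fun A : Matrix (Fin m) (Fin m) ℝ => ∑ j, ∑ l, |A j l|).tendsto
      S⁻¹).comp hinv
  have hunit : ∀ᶠ k in atTop, (sampleVar (x k)).det ≠ 0 :=
    (continuous_id.matrix_det.tendsto S |>.comp h.tendsto_sampleVar).eventually_ne hdet
  set K := ∑ j, ∑ l, |S⁻¹ j l| + 1
  refine ⟨max (K * M ^ 2) (K ^ (p / 2) * (2 ^ (p - 1) * (M + (1 + 2 * M) ^ p))), ?_⟩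
  filter_upwards [hunit, hentries.eventually_le_const (lt_add_one _),
    h.tendsto_size.eventually_gt_atTop 0] with k hk hK hn
  exact isStandardized_standardize hn hp ((isUnit_iff_isUnit_det _).2 hk.isUnit) hK
    (h.norm_sum_sub_le k) (h.average_norm_rpow_le k)

theorem tendstoInDistribution_meanVec (h : IsRegular x μ S p M) (hS : IsUnit S) (hp : 2 < p)
    (hR : Tendsto R atTop atTop) (hRn : Tendsto (fun k => (R k : ℝ) / n k) atTop (𝓝 0)) :
    TendstoInDistribution (fun k => meanVec (R := R k) (x k) (μ k)) atTop id
      (fun k => permLaw (n k) (R k)) (stdNormal m) := by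
  obtain ⟨C, hz⟩ := h.exists_eventually_isStandardized hS (by linarith)
  have hn := h.tendsto_size
  have haverage : ∀ f : (Fin m → ℝ) → ℝ,
      (fun k => (n k : ℝ)⁻¹ * ∑ i, f (standardize (x k) (μ k) i)) =ᶠ[atTop] fun k =>
        ∫ σ, f (invSqrt (sampleVar (x k)) *ᵥ (drawn (x k) σ 0 - μ k)) ∂uniformOn Set.univ := by
    intro f
    filter_upwards [hn.eventually_gt_atTop 0] with k hk
    exact (integral_drawn_zero hk (x k) fun u => f (invSqrt (sampleVar (x k)) *ᵥ (u - μ k))).symm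
  refine tendstoInDistribution_inv_sqrt_smul_sum_pi (ν := fun k => uniformOn Set.univ)
    (W := fun k σ => invSqrt (sampleVar (x k)) *ᵥ (drawn (x k) σ 0 - μ k)) hR hp
    (fun _ _ => .of_discrete) (fun t => ?_) (fun t => ?_) fun t => ⟨(t ⬝ᵥ t) ^ (p / 2) * C, ?_⟩
  · exact (tendsto_sqrt_mul_average_dotProduct hn hRn hz t).congr'
      ((haverage fun u => t ⬝ᵥ u).mono fun k hk => congrArg (√(R k : ℝ) * ·) hk)
  · exact (tendsto_average_dotProduct_sq hn hz t).congr' (haverage fun u => (t ⬝ᵥ u) ^ 2)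
  · filter_upwards [eventually_average_abs_dotProduct_rpow_le hn hz (by linarith) t,
      haverage fun u => |t ⬝ᵥ u| ^ p] with k hk hk'
    exact hk'.symm.trans_le hk

theorem tendstoInDistribution_uStat (h : IsRegular x μ S p M) (hm : 0 < m) (hS : IsUnit S)
    (hp : 2 < p) (hR : Tendsto R atTop atTop)
    (hRn : Tendsto (fun k => √(R k : ℝ) / n k) atTop (𝓝 0)) :
    TendstoInDistribution (fun k => uStat (R := R k) (x k) (μ k)) atTop id
      (fun k => permLaw (n k) (R k)) (gaussianReal 0 1) := by
  obtain ⟨C, hz⟩ := h.exists_eventually_isStandardized hS (by linarith)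
  have hn := h.tendsto_size
  have haverage : ∀ f : ℝ → ℝ,
      (fun k => ((n k : ℝ) * (n k - 1))⁻¹ * ∑ i ∈ Finset.univ.offDiag,
        f (standardize (x k) (μ k) i.1 ⬝ᵥ standardize (x k) (μ k) i.2)) =ᶠ[atTop] fun k =>
        ∫ σ, f ((drawn (x k) σ 0 - μ k) ⬝ᵥ (sampleVar (x k))⁻¹ *ᵥ (drawn (x k) σ 1 - μ k))
          ∂uniformOn Set.univ := by
    intro f
    filter_upwards [hn.eventually_gt_atTop 1] with k hk
    simp only [standardize, dotProduct_invSqrt_mulVec (posSemidef_sampleVar (x k))]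
    exact (integral_drawn_zero_one hk (x k)
      fun u v => f ((u - μ k) ⬝ᵥ (sampleVar (x k))⁻¹ *ᵥ (v - μ k))).symm
  have hm' : √(m : ℝ) ≠ 0 := (Real.sqrt_pos.2 (by exact_mod_cast hm)).ne'
  have hlaw : HasLaw (fun y : ℝ => √(m : ℝ) * y) (gaussianReal 0 m) (gaussianReal 0 1) :=
    ⟨by fun_prop, by
      rw [gaussianReal_map_const_mul, mul_zero, mul_one]
      congr 1
      exact NNReal.eq (Real.sq_sqrt m.cast_nonneg)⟩
  have hclt := tendstoInDistribution_inv_sqrt_mul_sum_pi hlaw hR hp (fun _ => .of_discrete)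
    ((tendsto_sqrt_mul_average_offDiag_dotProduct hn hRn hz).congr'
      ((haverage id).mono fun k hk => congrArg (√(R k : ℝ) * ·) hk))
    ((tendsto_average_offDiag_dotProduct_sq hn hp hz).congr' (haverage (· ^ 2)))
    (by
      filter_upwards [eventually_average_offDiag_abs_dotProduct_rpow_le hn hz (by linarith),
        haverage fun u => |u| ^ p] with k hk hk'
      exact hk'.symm.trans_le hk)
  convert hclt.continuous_comp (continuous_const_mul (√(m : ℝ))⁻¹) using 1
  · funext k π
    simp [uStat, Real.sqrt_mul, mul_assoc, mul_comm]
  · funext y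
    simp [hm']
  · rfl

end IsRegular

end RegularData

section ConvergenceInProbability

variable {Ω : ℕ → Type*}

lemma exists_forall_abs_sub_le_of_forall_seq {E ι : Type*} [Norm E] {a : ∀ n, Ω n → E}
    {b : ι → ∀ n, Ω n → ℝ} {c : ι → ℝ} {f : ∀ n, Ω n → ℝ} {y : ℝ}
    (hf : ∀ (n : ℕ → ℕ) (ω : ∀ k, Ω (n k)) (M : ℝ), Tendsto n atTop atTop →
      (∀ k, ‖a (n k) (ω k)‖ ≤ M) → (∀ i, Tendsto (fun k => b i (n k) (ω k)) atTop (𝓝 (c i))) →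
      Tendsto (fun k => f (n k) (ω k)) atTop (𝓝 y)) {ε : ℝ} (hε : 0 < ε) (M : ℝ) :
    ∃ η : ℝ, 0 < η ∧ ∃ N : ℕ, ∀ n, N ≤ n → ∀ ω, ‖a n ω‖ ≤ M → (∀ i, |b i n ω - c i| ≤ η) →
      |f n ω - y| ≤ ε := by
  by_contra! hcon
  choose n hn ω ha hb hfar using fun k : ℕ => hcon (1 / ((k : ℝ) + 1)) (by positivity) k
  have hlim := hf n ω M (tendsto_atTop_mono hn tendsto_id) ha fun i =>
    tendsto_iff_norm_sub_tendsto_zero.2 (squeeze_zero (fun _ => norm_nonneg _) (fun k => hb k i)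
      tendsto_one_div_add_atTop_nhds_zero_nat)
  obtain ⟨k, hk⟩ := (hlim.eventually (Metric.ball_mem_nhds y hε)).exists
  exact (hfar k).not_gt hk

variable [∀ n, MeasurableSpace (Ω n)] {P : ∀ n, Measure (Ω n)}

lemma BoundedInProb.exists_eventually_measure_le {E : Type*} [Norm E] {Y : ∀ n, Ω n → E}
    (h : BoundedInProb P Y) {ε : ENNReal} (hε : 0 < ε) :
    ∃ M : ℝ, ∀ᶠ n in atTop, P n {ω | M < ‖Y n ω‖} ≤ ε := by
  obtain ⟨e, -, he0, he⟩ := ENNReal.lt_iff_exists_real_btwn.1 hε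
  obtain ⟨M, hM⟩ := h e (ENNReal.ofReal_pos.1 he0)
  exact ⟨M, hM.mono fun n hn => hn.trans he.le⟩

lemma BoundedInProb.prodMk {E F : Type*} [Norm E] [Norm F] {Y : ∀ n, Ω n → E} {Z : ∀ n, Ω n → F}
    (hY : BoundedInProb P Y) (hZ : BoundedInProb P Z) :
    BoundedInProb P fun n ω => (Y n ω, Z n ω) := by
  intro ε hε
  obtain ⟨M, hM⟩ := hY (ε / 2) (half_pos hε)
  obtain ⟨N, hN⟩ := hZ (ε / 2) (half_pos hε)
  refine ⟨max M N, ?_⟩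
  filter_upwards [hM, hN] with n hn hn'
  have hsub : {ω | max M N < ‖(Y n ω, Z n ω)‖} ⊆ {ω | M < ‖Y n ω‖} ∪ {ω | N < ‖Z n ω‖} := by
    intro ω hω
    simp only [Set.mem_ofPred_eq, Prod.norm_def, max_lt_iff, lt_max_iff] at hω
    exact hω.imp And.left And.right
  calc _ ≤ ENNReal.ofReal (ε / 2) + ENNReal.ofReal (ε / 2) :=
        (measure_mono hsub).trans ((measure_union_le _ _).trans (add_le_add hn hn'))
    _ = ENNReal.ofReal ε := by
        rw [← ENNReal.ofReal_add (half_pos hε).le (half_pos hε).le, add_halves]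

theorem tendstoInProb_of_forall_seq {E ι : Type*} [Norm E] [Finite ι] {a : ∀ n, Ω n → E}
    {b : ι → ∀ n, Ω n → ℝ} {c : ι → ℝ} {f : ∀ n, Ω n → ℝ} {y : ℝ} (ha : BoundedInProb P a)
    (hb : ∀ i, TendstoInProb P (b i) (c i))
    (hf : ∀ (n : ℕ → ℕ) (ω : ∀ k, Ω (n k)) (M : ℝ), Tendsto n atTop atTop →
      (∀ k, ‖a (n k) (ω k)‖ ≤ M) → (∀ i, Tendsto (fun k => b i (n k) (ω k)) atTop (𝓝 (c i))) →
      Tendsto (fun k => f (n k) (ω k)) atTop (𝓝 y)) :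
    TendstoInProb P f y := by
  cases nonempty_fintype ι
  intro ε hε
  rw [ENNReal.tendsto_nhds_zero]
  intro ε' hε'
  obtain ⟨M, hM⟩ := ha.exists_eventually_measure_le (ENNReal.half_pos hε'.ne')
  obtain ⟨η, hη, N, hN⟩ := exists_forall_abs_sub_le_of_forall_seq hf hε M
  have hsum : Tendsto (fun n => ∑ i, P n {ω | η < |b i n ω - c i|}) atTop (𝓝 0) := by
    simpa only [Finset.sum_const_zero] using tendsto_finsetSum Finset.univ fun i _ => hb i η hη
  filter_upwards [hM, hsum.eventually_le_const (ENNReal.half_pos hε'.ne'), eventually_ge_atTop N]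
    with n hn hn' hNn
  have hsub : {ω | ε < |f n ω - y|} ⊆
      {ω | M < ‖a n ω‖} ∪ ⋃ i ∈ Finset.univ, {ω | η < |b i n ω - c i|} := by
    intro ω hω
    by_contra hcon
    simp only [Set.mem_union, Set.mem_iUnion, Set.mem_ofPred_eq, not_or, not_exists, not_lt,
      Finset.mem_univ, true_implies] at hcon
    exact (hN n hNn ω hcon.1 hcon.2).not_gt hω
  calc P n {ω | ε < |f n ω - y|}
      ≤ P n {ω | M < ‖a n ω‖} + ∑ i, P n {ω | η < |b i n ω - c i|} :=
        (measure_mono hsub).trans ((measure_union_le _ _).trans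
          (add_le_add_right (measure_biUnion_finset_le _ _) _))
    _ ≤ ε' / 2 + ε' / 2 := add_le_add hn hn'
    _ = ε' := ENNReal.add_halves ε'

lemma TendstoInProb.congr_ae {f g : ∀ n, Ω n → ℝ} {y : ℝ} (h : TendstoInProb P f y)
    (hfg : ∀ n, f n =ᵐ[P n] g n) : TendstoInProb P g y := fun ε hε =>
  (h ε hε).congr fun n => measure_congr <| (hfg n).mono fun _ hω =>
    congrArg (fun u => ε < |u - y|) hω

lemma abs_integral_sub_le {Ω : Type*} [MeasurableSpace Ω] {P : Measure Ω} [IsProbabilityMeasure P]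
    {f : Ω → ℝ} {y K ε : ℝ} (hf : Measurable f) (hK : ∀ ω, |f ω| ≤ K) (hε : 0 ≤ ε) :
    |∫ ω, f ω ∂P - y| ≤ ε + (K + |y|) * P.real {ω | ε < |f ω - y|} := by
  have hint : Integrable f P := .of_bound hf.aestronglyMeasurable K (.of_forall hK)
  have hs : MeasurableSet {ω | ε < |f ω - y|} :=
    measurableSet_lt measurable_const (hf.sub_const y).abs
  have hind := (integrable_const (K + |y|)).indicator (μ := P) hs
  have hpointwise : ∀ ω, |f ω - y| ≤ ε + {ω | ε < |f ω - y|}.indicator (fun _ => K + |y|) ω := by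
    intro ω
    by_cases hω : ε < |f ω - y|
    · rw [Set.indicator_of_mem (Set.mem_ofPred_eq ▸ hω)]
      linarith [abs_sub (f ω) y, hK ω]
    · rw [Set.indicator_of_notMem (Set.mem_ofPred_eq ▸ hω)]
      linarith
  calc |∫ ω, f ω ∂P - y| = |∫ ω, (f ω - y) ∂P| := by
        rw [integral_sub hint (integrable_const _)]; simp
    _ ≤ ∫ ω, |f ω - y| ∂P := abs_integral_le_integral_abs
    _ ≤ ∫ ω, (ε + {ω | ε < |f ω - y|}.indicator (fun _ => K + |y|) ω) ∂P :=
        integral_mono (hint.sub (integrable_const _)).abs ((integrable_const _).add hind) hpointwise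
    _ = _ := by
        rw [integral_add (integrable_const _) hind, integral_indicator_const _ hs]
        simp [mul_comm]

lemma TendstoInProb.tendsto_integral [∀ n, IsProbabilityMeasure (P n)] {f : ∀ n, Ω n → ℝ}
    {y K : ℝ} (h : TendstoInProb P f y) (hf : ∀ n, Measurable (f n)) (hK : ∀ n ω, |f n ω| ≤ K) :
    Tendsto (fun n => ∫ ω, f n ω ∂P n) atTop (𝓝 y) := by
  rw [Metric.tendsto_nhds]
  intro ε hε
  have hfar : Tendsto (fun n => (K + |y|) * (P n).real {ω | ε / 2 < |f n ω - y|}) atTop (𝓝 0) := by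
    simpa only [mul_zero, ENNReal.toReal_zero, Function.comp_def, measureReal_def] using
      ((ENNReal.tendsto_toReal ENNReal.zero_ne_top).comp (h _ (half_pos hε))).const_mul (K + |y|)
  filter_upwards [hfar.eventually_lt_const (half_pos hε)] with n hn
  rw [Real.dist_eq]
  linarith [abs_integral_sub_le (y := y) (P := P n) (hf n) (hK n) (half_pos hε).le]

end ConvergenceInProbability

section ConditionalLaw

lemma condDistrib_ae_eq_map_of_indepFun {Ω D Γ E : Type*} [MeasurableSpace Ω] [MeasurableSpace D]
    [MeasurableSpace Γ] [MeasurableSpace E] [StandardBorelSpace E] [Nonempty E] {P : Measure Ω}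
    [IsProbabilityMeasure P] {X : Ω → D} {G : Ω → Γ} {Q : Measure Γ} [IsProbabilityMeasure Q]
    (hX : AEMeasurable X P) (hG : HasLaw G Q P) (hind : IndepFun X G P) {T : D × Γ → E}
    (hT : Measurable T) :
    ∀ᵐ ω ∂P, condDistrib (fun ω => T (X ω, G ω)) X P (X ω) = Q.map fun g => T (X ω, g) := by
  have := Measure.isProbabilityMeasure_map hX
  let κ : Kernel D E := (Kernel.id ×ₖ Kernel.const D Q).map T
  have hκ : ∀ x, κ x = Q.map fun g => T (x, g) := fun x => by
    rw [Kernel.map_apply _ hT, Kernel.prod_apply, Kernel.id_apply, Kernel.const_apply,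
      Measure.dirac_prod, Measure.map_map hT measurable_prodMk_left, Function.comp_def]
  have : IsMarkovKernel κ := Kernel.IsMarkovKernel.map _ hT
  have hpair : Measurable fun q : D × Γ => (q.1, T q) := measurable_fst.prodMk hT
  have hjoint : P.map (fun ω => (X ω, T (X ω, G ω))) = P.map X ⊗ₘ κ := by
    have hprod : P.map (fun ω => (X ω, G ω)) = (P.map X).prod Q := by
      rw [(indepFun_iff_map_prod_eq_prod_map_map hX hG.aemeasurable).1 hind, hG.map_eq]
    calc P.map (fun ω => (X ω, T (X ω, G ω)))
        = ((P.map X).prod Q).map fun q => (q.1, T q) := by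
          rw [← hprod, AEMeasurable.map_map_of_aemeasurable hpair.aemeasurable
            (hX.prodMk hG.aemeasurable), Function.comp_def]
      _ = P.map X ⊗ₘ κ := by
          ext s hs
          rw [Measure.map_apply hpair hs, Measure.prod_apply (hpair hs), Measure.compProd_apply hs]
          refine lintegral_congr fun x => ?_
          have hTx : Measurable fun g => T (x, g) := hT.comp measurable_prodMk_left
          rw [hκ, Measure.map_apply hTx (measurable_prodMk_left hs)]
          rfl
  filter_upwards [ae_of_ae_map hX (condDistrib_ae_eq_of_measure_eq_compProd X
    (hT.comp_aemeasurable (hX.prodMk hG.aemeasurable)) hjoint)] with ω hω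
  exact hω.trans (hκ _)

lemma integral_integral_condDistrib {Ω D E : Type*} [MeasurableSpace Ω] [MeasurableSpace D]
    [MeasurableSpace E] [StandardBorelSpace E] [Nonempty E] {P : Measure Ω} [IsFiniteMeasure P]
    {X : Ω → D} {T : Ω → E} (hX : Measurable X) (hT : AEMeasurable T P) {f : E → ℝ}
    (hf : StronglyMeasurable f) (hint : Integrable (fun ω => f (T ω)) P) :
    ∫ ω, ∫ y, f y ∂condDistrib T X P (X ω) ∂P = ∫ ω, f (T ω) ∂P := by
  rw [← integral_congr_ae (condExp_ae_eq_integral_condDistrib hX hT hf hint),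
    integral_condExp hX.comap_le]

end ConditionalLaw

section ConditionalConvergence

variable {Ω D : ℕ → Type*} [∀ n, MeasurableSpace (Ω n)] [∀ n, MeasurableSpace (D n)]
  {E : Type*} [TopologicalSpace E] [MeasurableSpace E] [OpensMeasurableSpace E]
  [StandardBorelSpace E] [Nonempty E] {P : ∀ n, Measure (Ω n)} [∀ n, IsProbabilityMeasure (P n)]
  {X : ∀ n, Ω n → D n} {T : ∀ n, Ω n → E} {ν : ProbabilityMeasure E}

/-- Conditionally on the data `Xₙ`, the statistic `Tₙ` converges in distribution to `ν`, in
probability. Weak convergence of the random conditional laws is expressed through all functionals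
of the law that are continuous at `ν`. -/
structure CondTendstoInDistribution (P : ∀ n, Measure (Ω n)) [∀ n, IsProbabilityMeasure (P n)]
    (X : ∀ n, Ω n → D n) (T : ∀ n, Ω n → E) (ν : ProbabilityMeasure E) : Prop where
  measurable_data : ∀ n, Measurable (X n)
  aemeasurable_stat : ∀ n, AEMeasurable (T n) (P n)
  tendstoInProb : ∀ F : ProbabilityMeasure E → ℝ, ContinuousAt F ν →
    TendstoInProb P (fun n ω => F ⟨condDistrib (T n) (X n) (P n) (X n ω), inferInstance⟩) (F ν)

namespace CondTendstoInDistribution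

lemma condCDFTendsto [HasOuterApproxClosed E] [Preorder E]
    (h : CondTendstoInDistribution P X T ν)
    (hν : ∀ t, (ν : Measure E) (frontier (Set.Iic t)) = 0) : CondCDFTendsto P X T ν := fun t =>
  h.tendstoInProb (fun ρ => (ρ : Measure E).real (Set.Iic t))
    (continuousAt_measureReal_of_null_frontier (hν t))

lemma condCDFTendstoUniformly {T : ∀ n, Ω n → ℝ} {ν : Measure ℝ} [hν : IsProbabilityMeasure ν]
    [hν₀ : NullSingletonClass ν] (h : CondTendstoInDistribution P X T ⟨ν, hν⟩) :
    CondCDFTendstoUniformly P X T ν := by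
  have hsup := h.tendstoInProb _ (@continuousAt_iSup_abs_sub_measureReal_Iic ⟨ν, hν⟩ hν₀)
  simp only [sub_self, abs_zero, ciSup_const] at hsup
  exact hsup

lemma tendstoInDistribution (h : CondTendstoInDistribution P X T ν) :
    TendstoInDistribution T atTop id P (ν : Measure E) := by
  refine ⟨h.aemeasurable_stat, aemeasurable_id, ?_⟩
  refine ProbabilityMeasure.tendsto_iff_forall_integral_tendsto.2 fun f => ?_
  simp only [ProbabilityMeasure.coe_mk, Measure.map_id]
  have hf := f.continuous.measurable
  have hint : ∀ n, Integrable (fun ω => f (T n ω)) (P n) := fun n =>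
    .of_bound (hf.comp_aemeasurable (h.aemeasurable_stat n)).aestronglyMeasurable ‖f‖
      (.of_forall fun _ => f.norm_coe_le_norm _)
  have hprob := h.tendstoInProb (fun ρ => ∫ y, f y ∂(ρ : Measure E))
    (ProbabilityMeasure.tendsto_iff_forall_integral_tendsto.1 tendsto_id f)
  refine (hprob.tendsto_integral (K := ‖f‖) (fun n => ?_) fun n ω => ?_).congr fun n => ?_
  · exact (StronglyMeasurable.integral_condDistrib
      (hf.comp measurable_snd).stronglyMeasurable).measurable.comp (h.measurable_data n)
  · simpa using norm_integral_le_of_norm_le_const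
      (μ := condDistrib (T n) (X n) (P n) (X n ω)) (.of_forall fun y => f.norm_coe_le_norm y)
  · rw [integral_map (h.aemeasurable_stat n) hf.aestronglyMeasurable]
    exact integral_integral_condDistrib (h.measurable_data n) (h.aemeasurable_stat n)
      hf.stronglyMeasurable (hint n)

lemma continuous_comp {E' : Type*} [TopologicalSpace E'] [MeasurableSpace E'] [BorelSpace E']
    [StandardBorelSpace E'] [Nonempty E'] (h : CondTendstoInDistribution P X T ν) {g : E → E'}
    (hg : Continuous g) :
    CondTendstoInDistribution P X (fun n ω => g (T n ω)) (ν.map hg.measurable.aemeasurable) where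
  measurable_data := h.measurable_data
  aemeasurable_stat n := hg.measurable.comp_aemeasurable (h.aemeasurable_stat n)
  tendstoInProb F hF := by
    have hmap : ContinuousAt (fun ρ : ProbabilityMeasure E => F (ρ.map hg.measurable.aemeasurable))
        ν := hF.comp (f := fun ρ : ProbabilityMeasure E => ρ.map hg.measurable.aemeasurable)
          (ProbabilityMeasure.continuous_map hg).continuousAt
    refine (h.tendstoInProb _ hmap).congr_ae fun n => ?_
    filter_upwards [ae_of_ae_map (h.measurable_data n).aemeasurable
      (condDistrib_comp (X n) (h.aemeasurable_stat n) hg.measurable)] with ω hω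
    refine congrArg F (Subtype.ext ?_)
    exact (Kernel.map_apply _ hg.measurable _).symm.trans hω.symm

end CondTendstoInDistribution

end ConditionalConvergence

section Measurability

open Matrix

variable {n m R : ℕ}

lemma continuous_sampleMean : Continuous (sampleMean : (Fin n → Fin m → ℝ) → Fin m → ℝ) := by
  unfold sampleMean; fun_prop

lemma continuous_sampleVar :
    Continuous (sampleVar : (Fin n → Fin m → ℝ) → Matrix (Fin m) (Fin m) ℝ) := by
  have := continuous_sampleMean (n := n) (m := m)
  unfold sampleVar
  fun_prop

lemma measurable_inv_apply {α : Type*} [TopologicalSpace α] [MeasurableSpace α]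
    [OpensMeasurableSpace α] {A : α → Matrix (Fin m) (Fin m) ℝ} (hA : Continuous A)
    (j l : Fin m) : Measurable fun a => (A a)⁻¹ j l := by
  simp only [inv_def, Ring.inverse_eq_inv', Matrix.smul_apply, smul_eq_mul]
  exact hA.matrix_det.measurable.inv.mul (hA.matrix_adjugate.matrix_elem j l).measurable

open scoped MatrixOrder Matrix.Norms.L2Operator in
lemma continuousOn_matrix_sqrt :
    ContinuousOn (CFC.sqrt : Matrix (Fin m) (Fin m) ℝ → Matrix (Fin m) (Fin m) ℝ) {A | 0 ≤ A} :=
  CFC.continuousOn_sqrt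

open scoped MatrixOrder in
lemma measurable_invSqrt_sampleVar_apply (j l : Fin m) :
    Measurable fun x : Fin n → Fin m → ℝ => invSqrt (sampleVar x) j l :=
  measurable_inv_apply (continuousOn_matrix_sqrt.comp_continuous continuous_sampleVar
    fun x => (posSemidef_sampleVar x).nonneg) j l

lemma measurable_mulVec {α : Type*} [MeasurableSpace α] {A : α → Matrix (Fin m) (Fin m) ℝ}
    {v : α → Fin m → ℝ} (hA : ∀ j l, Measurable fun a => A a j l) (hv : Measurable v) :
    Measurable fun a => A a *ᵥ v a := by
  simp only [mulVec, dotProduct, measurable_pi_iff]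
  exact fun j => Finset.measurable_sum _ fun l _ => (hA j l).mul ((measurable_pi_apply l).comp hv)

lemma measurable_drawn (σ : Equiv.Perm (Fin n)) (k : ℕ) :
    Measurable fun x : Fin n → Fin m → ℝ => drawn x σ k := by
  unfold drawn
  split_ifs <;> fun_prop

variable {μ : (Fin n → Fin m → ℝ) → Fin m → ℝ}

lemma measurable_meanVec (hμ : Measurable μ) :
    Measurable fun q : (Fin n → Fin m → ℝ) × (Fin R → Equiv.Perm (Fin n)) =>
      meanVec q.1 (μ q.1) q.2 := by
  refine measurable_from_prod_countable_left fun π => Measurable.const_smul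
    (Finset.measurable_sum _ fun r _ => ?_) (√(R : ℝ))⁻¹
  exact measurable_mulVec measurable_invSqrt_sampleVar_apply ((measurable_drawn (π r) 0).sub hμ)

lemma measurable_uStat (hμ : Measurable μ) :
    Measurable fun q : (Fin n → Fin m → ℝ) × (Fin R → Equiv.Perm (Fin n)) =>
      uStat q.1 (μ q.1) q.2 := by
  refine measurable_from_prod_countable_left fun π =>
    (Finset.measurable_sum _ fun r _ => ?_).const_mul _
  have hdot : Measurable fun q : (Fin m → ℝ) × (Fin m → ℝ) => q.1 ⬝ᵥ q.2 :=
    (by fun_prop : Continuous fun q : (Fin m → ℝ) × (Fin m → ℝ) => q.1 ⬝ᵥ q.2).measurable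
  exact hdot.comp (((measurable_drawn (π r) 0).sub hμ).prodMk
    (measurable_mulVec (measurable_inv_apply continuous_sampleVar)
      ((measurable_drawn (π r) 1).sub hμ)))

end Measurability

section RegularSampling

open Matrix

variable {m : ℕ} {Ω : ℕ → Type*} [∀ n, MeasurableSpace (Ω n)] {P : ∀ n, Measure (Ω n)}
  {X : ∀ n, Ω n → Fin n → Fin m → ℝ} {R : ℕ → ℕ} {π : ∀ n, Ω n → Fin (R n) → Equiv.Perm (Fin n)}
  {μ : ∀ n, (Fin n → Fin m → ℝ) → Fin m → ℝ} {S : Matrix (Fin m) (Fin m) ℝ} {p : ℝ}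

/-- The resampling scheme: the `π n` consist of independent uniform permutations and are
independent of the data `X n`. -/
structure IsPermutationResampling (P : ∀ n, Measure (Ω n)) (X : ∀ n, Ω n → Fin n → Fin m → ℝ)
    (π : ∀ n, Ω n → Fin (R n) → Equiv.Perm (Fin n)) : Prop where
  measurable_data : ∀ n, Measurable (X n)
  hasLaw_perm : ∀ n, HasLaw (π n) (permLaw n (R n)) (P n)
  indepFun : ∀ n, IndepFun (X n) (π n) (P n)

/-- The assumptions on the triangular array, for a centre `μ` which may be computed from the data:
root-`n` consistency, bounded `p`-th sample moments and convergence of the sample variance to `S`,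
all in probability. -/
structure IsRegularInProb (P : ∀ n, Measure (Ω n)) (X : ∀ n, Ω n → Fin n → Fin m → ℝ)
    (μ : ∀ n, (Fin n → Fin m → ℝ) → Fin m → ℝ) (S : Matrix (Fin m) (Fin m) ℝ) (p : ℝ) : Prop where
  measurable_centre : ∀ n, Measurable (μ n)
  boundedInProb_sum_sub : BoundedInProb P fun n ω => (√(n : ℝ))⁻¹ • ∑ i, (X n ω i - μ n (X n ω))
  boundedInProb_average_norm_rpow :
    BoundedInProb P fun n ω => (n : ℝ)⁻¹ * ∑ i, ‖X n ω i‖ ^ p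
  tendstoInProb_sampleVar :
    ∀ j l, TendstoInProb P (fun n ω => sampleVar (X n ω) j l) (S j l)

lemma hasLaw_permLaw {Ω : Type*} [MeasurableSpace Ω] {P : Measure Ω} [IsProbabilityMeasure P]
    {n R : ℕ} {π : Ω → Fin R → Equiv.Perm (Fin n)} (hπ : ∀ r, AEMeasurable (fun ω => π ω r) P)
    (hunif : ∀ r, P.map (fun ω => π ω r) = uniformOn Set.univ)
    (hindep : iIndepFun (fun r ω => π ω r) P) : HasLaw π (permLaw n R) P where
  aemeasurable := aemeasurable_pi_iff.2 hπ
  map_eq := by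
    rw [permLaw, ← funext hunif]
    exact (iIndepFun_iff_map_fun_eq_pi_map hπ).1 hindep

lemma boundedInProb_sum_sub_sampleMean :
    BoundedInProb P fun n ω => (√(n : ℝ))⁻¹ • ∑ i, (X n ω i - sampleMean (X n ω)) := by
  refine fun ε _ => ⟨0, .of_forall fun n => ?_⟩
  simp [sum_sub_eq_natCast_smul (X n _) (sampleMean (X n _))]

namespace IsRegularInProb

lemma tendstoInProb (h : IsRegularInProb P X μ S p) {f : ∀ n, (Fin n → Fin m → ℝ) → ℝ} {y : ℝ}
    (hf : ∀ (n : ℕ → ℕ) (x : ∀ k, Fin (n k) → Fin m → ℝ) (M : ℝ),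
      IsRegular x (fun k => μ (n k) (x k)) S p M → Tendsto (fun k => f (n k) (x k)) atTop (𝓝 y)) :
    TendstoInProb P (fun n ω => f n (X n ω)) y :=
  tendstoInProb_of_forall_seq
    (h.boundedInProb_sum_sub.prodMk h.boundedInProb_average_norm_rpow)
    (fun jl : Fin m × Fin m => h.tendstoInProb_sampleVar jl.1 jl.2)
    fun n ω M hn hbdd hvar => hf n (fun k => X (n k) (ω k)) M
      { tendsto_size := hn
        norm_sum_sub_le := fun k => (norm_fst_le _).trans (hbdd k)
        average_norm_rpow_le := fun k =>
          (Real.le_norm_self _).trans ((norm_snd_le _).trans (hbdd k))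
        tendsto_sampleVar := tendsto_pi_nhds.2 fun j => tendsto_pi_nhds.2 fun l => hvar (j, l) }

variable [∀ n, IsProbabilityMeasure (P n)]

theorem condTendstoInDistribution {E : Type*} [TopologicalSpace E] [MeasurableSpace E]
    [OpensMeasurableSpace E] [StandardBorelSpace E] [Nonempty E]
    (h : IsRegularInProb P X μ S p) (hπ : IsPermutationResampling P X π)
    {T : ∀ n, (Fin n → Fin m → ℝ) × (Fin (R n) → Equiv.Perm (Fin n)) → E}
    (hT : ∀ n, Measurable (T n)) {ν : ProbabilityMeasure E}
    (hlim : ∀ (n : ℕ → ℕ) (x : ∀ k, Fin (n k) → Fin m → ℝ) (M : ℝ),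
      IsRegular x (fun k => μ (n k) (x k)) S p M →
        TendstoInDistribution (fun k g => T (n k) (x k, g)) atTop id
          (fun k => permLaw (n k) (R (n k))) (ν : Measure E)) :
    CondTendstoInDistribution P X (fun n ω => T n (X n ω, π n ω)) ν where
  measurable_data := hπ.measurable_data
  aemeasurable_stat n := (hT n).comp_aemeasurable
    ((hπ.measurable_data n).aemeasurable.prodMk (hπ.hasLaw_perm n).aemeasurable)
  tendstoInProb F hF := by
    let law n (x : Fin n → Fin m → ℝ) : ProbabilityMeasure E :=
      ⟨(permLaw n (R n)).map fun g => T n (x, g),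
        Measure.isProbabilityMeasure_map Measurable.of_discrete.aemeasurable⟩
    have hlaw : TendstoInProb P (fun n ω => F (law n (X n ω))) (F ν) :=
      h.tendstoInProb (f := fun n x => F (law n x)) fun n x M hx => by
        have hx' := (hlim n x M hx).tendsto
        simp only [Measure.map_id] at hx'
        exact hF.tendsto.comp hx'
    refine hlaw.congr_ae fun n => ?_
    filter_upwards [condDistrib_ae_eq_map_of_indepFun (hπ.measurable_data n).aemeasurable
      (hπ.hasLaw_perm n) (hπ.indepFun n) (hT n)] with ω hω
    exact congrArg F (Subtype.ext hω.symm)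

theorem condTendstoInDistribution_meanVec (h : IsRegularInProb P X μ S p)
    (hπ : IsPermutationResampling P X π) (hS : IsUnit S) (hp : 2 < p)
    (hR : Tendsto R atTop atTop) (hRn : Tendsto (fun n => (R n : ℝ) / n) atTop (𝓝 0)) :
    CondTendstoInDistribution P X (fun n ω => meanVec (X n ω) (μ n (X n ω)) (π n ω))
      ⟨stdNormal m, inferInstance⟩ :=
  h.condTendstoInDistribution hπ (fun n => measurable_meanVec (h.measurable_centre n))
    fun _ _ _ hx => hx.tendstoInDistribution_meanVec hS hp (hR.comp hx.tendsto_size)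
      (hRn.comp hx.tendsto_size)

theorem condTendstoInDistribution_meanStat (h : IsRegularInProb P X μ S p)
    (hπ : IsPermutationResampling P X π) (hS : IsUnit S) (hp : 2 < p)
    (hR : Tendsto R atTop atTop) (hRn : Tendsto (fun n => (R n : ℝ) / n) atTop (𝓝 0)) :
    CondTendstoInDistribution P X (fun n ω => meanStat (X n ω) (μ n (X n ω)) (π n ω))
      ⟨chiSquare m, inferInstance⟩ := by
  have hsq : Continuous fun z : Fin m → ℝ => z ⬝ᵥ z := by fun_prop
  have hchi : (⟨chiSquare m, inferInstance⟩ : ProbabilityMeasure ℝ) =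
      ProbabilityMeasure.map ⟨stdNormal m, inferInstance⟩ hsq.measurable.aemeasurable :=
    Subtype.ext (by simp only [chiSquare, dotProduct, sq]; rfl)
  rw [hchi]
  exact (h.condTendstoInDistribution_meanVec hπ hS hp hR hRn).continuous_comp hsq

theorem condTendstoInDistribution_uStat (h : IsRegularInProb P X μ S p)
    (hπ : IsPermutationResampling P X π) (hm : 0 < m) (hS : IsUnit S) (hp : 2 < p)
    (hR : Tendsto R atTop atTop) (hRn : Tendsto (fun n => √(R n : ℝ) / n) atTop (𝓝 0)) :
    CondTendstoInDistribution P X (fun n ω => uStat (X n ω) (μ n (X n ω)) (π n ω))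
      ⟨gaussianReal 0 1, inferInstance⟩ :=
  h.condTendstoInDistribution hπ (fun n => measurable_uStat (h.measurable_centre n))
    fun _ _ _ hx => hx.tendstoInDistribution_uStat hm hS hp (hR.comp hx.tendsto_size)
      (hRn.comp hx.tendsto_size)

end IsRegularInProb

end RegularSampling

end Resampling

end

open Resampling in
theorem theorem1 {m : ℕ} (hm : 0 < m)
    -- the probability spaces; row `n` of the triangular array lives on the `n`-th one
    {Ω : ℕ → Type*} [∀ n, MeasurableSpace (Ω n)]
    (P : ∀ n, Measure (Ω n)) [∀ n, IsProbabilityMeasure (P n)]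
    -- the data: `X n ω i` is the `i`-th observation in the sample of size `n`
    (X : ∀ n, Ω n → Fin n → Fin m → ℝ) (hX : ∀ n, Measurable (X n))
    (μ₀ : ℕ → Fin m → ℝ)
    -- i.i.d. uniform permutations, independent of the data
    (R : ℕ → ℕ) (hR : ∀ n, 1 ≤ R n)
    (π : ∀ n, Ω n → Fin (R n) → Equiv.Perm (Fin n)) (hπ : ∀ n, Measurable (π n))
    (hπ_unif : ∀ n r, (P n).map (fun ω => π n ω r) = uniformOn Set.univ)
    (hπ_iid : ∀ n, iIndepFun (fun r ω => π n ω r) (P n))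
    (hπ_data : ∀ n, IndepFun (X n) (π n) (P n))
    -- root-`n` consistency
    (h_mean : BoundedInProb P fun n ω => (√(n : ℝ))⁻¹ • ∑ i, (X n ω i - μ₀ n))
    -- convergence of the sample variance
    (S : Matrix (Fin m) (Fin m) ℝ) (hS : S.PosDef)
    (h_var : ∀ j k, TendstoInProb P (fun n ω => sampleVar (X n ω) j k) (S j k))
    -- sample moments (the norm on `Fin m → ℝ` is the sup norm)
    (δ : ℝ) (hδ : 0 < δ)
    (h_mom : BoundedInProb P fun n ω => (n : ℝ)⁻¹ * ∑ i, ‖X n ω i‖ ^ (2 + δ))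
    (hR_top : Tendsto R atTop atTop) :
    (Tendsto (fun n => (R n : ℝ) / n) atTop (𝓝 0) →
      (CondCDFTendsto P X (fun n ω => meanVec (X n ω) (μ₀ n) (π n ω)) (stdNormal m) ∧
        CondCDFTendsto P X (fun n ω => meanVec (X n ω) (sampleMean (X n ω)) (π n ω))
          (stdNormal m)) ∧
      (TendstoInDistribution (fun n ω => meanStat (X n ω) (μ₀ n) (π n ω)) atTop id P
          (chiSquare m) ∧
        TendstoInDistribution (fun n ω => meanStat (X n ω) (sampleMean (X n ω)) (π n ω)) atTop id P
          (chiSquare m)) ∧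
      (CondCDFTendstoUniformly P X (fun n ω => meanStat (X n ω) (μ₀ n) (π n ω)) (chiSquare m) ∧
        CondCDFTendstoUniformly P X (fun n ω => meanStat (X n ω) (sampleMean (X n ω)) (π n ω))
          (chiSquare m))) ∧
    (Tendsto (fun n => √(R n : ℝ) / n) atTop (𝓝 0) →
      (TendstoInDistribution (fun n ω => uStat (X n ω) (μ₀ n) (π n ω)) atTop id P
          (gaussianReal 0 1) ∧
        TendstoInDistribution (fun n ω => uStat (X n ω) (sampleMean (X n ω)) (π n ω)) atTop id P
          (gaussianReal 0 1)) ∧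
      (CondCDFTendstoUniformly P X (fun n ω => uStat (X n ω) (μ₀ n) (π n ω)) (gaussianReal 0 1) ∧
        CondCDFTendstoUniformly P X (fun n ω => uStat (X n ω) (sampleMean (X n ω)) (π n ω))
          (gaussianReal 0 1))) := by
  have := nullSingletonClass_chiSquare hm
  have := nullSingletonClass_gaussianReal (μ := 0) (one_ne_zero : (1 : NNReal) ≠ 0)
  have hp : 2 < 2 + δ := lt_add_of_pos_right 2 hδ
  have hperm : IsPermutationResampling P X π :=
    ⟨hX, fun n => hasLaw_permLaw (fun r => ((measurable_pi_apply r).comp (hπ n)).aemeasurable)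
      (hπ_unif n) (hπ_iid n), hπ_data⟩
  have hμ₀ : IsRegularInProb P X (fun n _ => μ₀ n) S (2 + δ) :=
    ⟨fun _ => measurable_const, h_mean, h_mom, h_var⟩
  have hmean : IsRegularInProb P X (fun _ => sampleMean) S (2 + δ) :=
    ⟨fun _ => continuous_sampleMean.measurable, boundedInProb_sum_sub_sampleMean, h_mom, h_var⟩
  refine ⟨fun hRn => ?_, fun hRn => ?_⟩
  · have hV₀ := hμ₀.condTendstoInDistribution_meanVec hperm hS.isUnit hp hR_top hRn
    have hV := hmean.condTendstoInDistribution_meanVec hperm hS.isUnit hp hR_top hRn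
    have hT₀ := hμ₀.condTendstoInDistribution_meanStat hperm hS.isUnit hp hR_top hRn
    have hT := hmean.condTendstoInDistribution_meanStat hperm hS.isUnit hp hR_top hRn
    exact ⟨⟨hV₀.condCDFTendsto stdNormal_frontier_Iic, hV.condCDFTendsto stdNormal_frontier_Iic⟩,
      ⟨hT₀.tendstoInDistribution, hT.tendstoInDistribution⟩,
      hT₀.condCDFTendstoUniformly, hT.condCDFTendstoUniformly⟩
  · have hU₀ := hμ₀.condTendstoInDistribution_uStat hperm hm hS.isUnit hp hR_top hRn
    have hU := hmean.condTendstoInDistribution_uStat hperm hm hS.isUnit hp hR_top hRn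
    exact ⟨⟨hU₀.tendstoInDistribution, hU.tendstoInDistribution⟩,
      hU₀.condCDFTendstoUniformly, hU.condCDFTendstoUniformly⟩
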